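/- **Setting.** Let $d,s\ge 0$ be integers and let levels of code be numbered $t=1,\dots,s$. Level $t$ is run on a finite set of inputs $\mathcal X_t\subset\mathbb R^d$ with $n_t$ elements, and the designs are hierarchically nested, $\mathcal X_t\subset\mathcal X_{t-1}$ for $t\ge 2$. Let $\mathbf h_t:\mathbb R^d\to\mathbb R^{p_t}$ be vectors of basis functions, $\mathbf H_t=\mathbf h_t(\mathcal X_t)$, and let $r(\cdot,\cdot\mid\phi)$, $\phi\in(0,\infty)^d$, be correlation functions; the only properties of them that are used are that each $\mathbf R_t(\phi)=r(\mathcal X_t,\mathcal X_t\mid\phi)$ is symmetric positive definite and that its entries are differentiable in each coordinate of $\phi$, for all $\phi\in(0,\infty)^d$. The outputs are $\mathbf y=(\mathbf y_1,\dots,\mathbf y_s)$ with $\mathbf y_t\in\mathbb R^{\mathcal X_t}$. Put $\mathbf X_1=\mathbf H_1$ and $\mathbf X_t=[\mathbf H_t,\;y_{t-1}(\mathcal X_t)]$ for $t\ge 2$, let $q_t$ be the number of columns of $\mathbf X_t$, and let $\mathbf b_1=\boldsymbol\beta_1$, $\mathbf b_t=(\boldsymbol\beta_t,\gamma_{t-1})\in\mathbb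 R^{q_t}$ for $t\ge2$. The autoregressive cokriging model has the sampling density $$L(\mathbf y\mid\boldsymbol\beta,\boldsymbol\gamma,\boldsymbol\sigma^2,\boldsymbol\phi)=\prod_{t=1}^s \mathcal N\big(\mathbf y_t;\ \mathbf X_t\mathbf b_t,\ \sigma_t^2\mathbf R_t(\boldsymbol\phi_t)\big),$$ where $\sigma_t^2>0$ and $\boldsymbol\phi_t\in(0,\infty)^d$. The observed $\mathbf y$ is assumed to be such that every $\mathbf X_t$ has linearly independent columns. **Independent reference prior.** The location parameters $(\boldsymbol\beta,\boldsymbol\gamma)$ are nuisance parameters with the flat prior $\pi^R(\boldsymbol\beta,\boldsymbol\gamma\mid\boldsymbol\sigma^2,\boldsymbol\phi)\propto1$. Let $L^I(\boldsymbol\sigma^2,\boldsymbol\phi\mid\mathbf y)=\int L(\mathbf y\mid\boldsymbol\beta,\boldsymbol\gamma,\boldsymbol\sigma^2,\boldsymbol\phi)\,d(\boldsymbol\beta,\boldsymbol\gamma)$ and $\ell^I=\log L^I$. For each $t$ let $\vartheta_t=(\sigma_t^2,\phi_{t,1},\dots,\phi_{t,d})$, and let $\mathcal I_t$ be the $(d+1)\times(d+1)$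 Fisher information matrix of $\vartheta_t$ in the integrated likelihood with all other parameters fixed, $$[\mathcal I_t]_{ij}=E\Big[\tfrac{\partial\ell^I}{\partial\vartheta_{t,i}}\,\tfrac{\partial\ell^I}{\partial\vartheta_{t,j}}\ \Big|\ \mathbf y_1,\dots,\mathbf y_{t-1}\Big],$$ the expectation being over $(\mathbf y_t,\dots,\mathbf y_s)$ under the sampling density with parameter $\boldsymbol\theta=(\boldsymbol\beta,\boldsymbol\gamma,\boldsymbol\sigma^2,\boldsymbol\phi)$, given the coarser outputs (so that the regression matrix $\mathbf X_t$ is fixed). The independent reference prior is, up to a constant factor, $$\pi^R(\boldsymbol\theta)=\pi^R(\boldsymbol\beta,\boldsymbol\gamma\mid\boldsymbol\sigma^2,\boldsymbol\phi)\prod_{t=1}^s|\mathcal I_t|^{1/2}.$$ **Theorem (Independent Reference Prior).** Let $\mathbf Q_t=\mathbf R_t^{-1}\{\mathbf I-\mathbf X_t(\mathbf X_t^\top\mathbf R_t^{-1}\mathbf X_t)^{-1}\mathbf X_t^\top\mathbf R_t^{-1}\}$, $\dot{\mathbf R}_t^k=\partial\mathbf R_t/\partial\phi_{t,k}$ (elementwise),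 $\mathbf W_{t,k}=\dot{\mathbf R}_t^k\mathbf Q_t$, and let $I_t^R(\boldsymbol\phi_t)$ be the symmetric $(d+1)\times(d+1)$ matrix $$I_t^R(\boldsymbol\phi_t)=\begin{pmatrix} n_t-q_t & \big(\mathrm{tr}(\mathbf W_{t,l})\big)_{l}\\ \big(\mathrm{tr}(\mathbf W_{t,k})\big)_{k} & \big(\mathrm{tr}(\mathbf W_{t,k}\mathbf W_{t,l})\big)_{k,l}\end{pmatrix},\qquad 1\le k,l\le d.$$ Then, for all $\boldsymbol\theta$ with $\sigma_t^2>0$ and $\boldsymbol\phi_t\in(0,\infty)^d$ for every $t$: 1. for each $t$ the Fisher information $\mathcal I_t$ exists (given the outputs below level $t$, for almost every value of the remaining ones the integral $L^I$ converges to a positive number and $\ell^I$ has all partial derivatives in $\vartheta_t$; the products of the scores have finite expectations), and, with $D_t=\mathrm{diag}(\sigma_t^{-2},1,\dots,1)$, $\mathcal I_t=\tfrac12 D_t\,I_t^R(\boldsymbol\phi_t)\,D_t$, that is, it is $I_t^R(\boldsymbol\phi_t)$ up to the factor $\tfrac12$ and the scale of $\sigma_t^2$; 2. the independent reference prior has the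 form $$\pi^R(\boldsymbol\theta)\propto\frac{\pi^R(\boldsymbol\phi)}{\prod_{t=1}^s(\sigma_t^2)^{a_t}},\qquad a_t=1,\qquad \pi^R(\boldsymbol\phi)\propto\prod_{t=1}^s|I_t^R(\boldsymbol\phi_t)|^{1/2},$$ with a positive constant of proportionality that does not depend on $\boldsymbol\theta$. -/

import Mathlib

open MeasureTheory Matrix

noncomputable section

namespace Cokriging

/-- Density at `y` of the multivariate normal law `N(m, V)`, for a positive definite `V`. -/
def gaussianDensity {ι : Type*} [Fintype ι] [DecidableEq ι]
    (m : ι → ℝ) (V : Matrix ι ι ℝ) (y : ι → ℝ) : ℝ :=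
  (2 * Real.pi) ^ (-(Fintype.card ι : ℝ) / 2) * V.det ^ (-(1 / 2) : ℝ) *
    Real.exp (-((y - m) ⬝ᵥ (V⁻¹ *ᵥ (y - m))) / 2)

/-- The data that specify an autoregressive cokriging model with `s` levels of code and inputs in
`ℝᵈ`. Levels are numbered from the coarsest, `0`, to the finest, `s - 1`. The design of level `t`
is a finite set of inputs, the designs are hierarchically nested, `h t` is the vector of the `p t`
basis functions of level `t`, and `r x x' φ` is `r(x, x' ∣ φ)`. -/
structure Model (d s : ℕ) where
  design : Fin s → Finset (Fin d → ℝ)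
  nested : ∀ t u : Fin s, u.val + 1 = t.val → design t ⊆ design u
  p : Fin s → ℕ
  h : (t : Fin s) → (Fin d → ℝ) → Fin (p t) → ℝ
  r : (Fin d → ℝ) → (Fin d → ℝ) → (Fin d → ℝ) → ℝ

variable {d s : ℕ}

/-- The level preceding `t`: no element if `t` is the first level, exactly one otherwise. -/
abbrev Pred (t : Fin s) : Type := {u : Fin s // u.val + 1 = t.val}

namespace Model

variable (M : Model d s)

/-- Index set of the location parameters `b_t = (β_t, γ_{t-1})` of level `t`
(at the first level there is no `γ`). Its cardinality is `q_t`. -/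
abbrev Col (t : Fin s) : Type := Fin (M.p t) ⊕ Pred t

/-- The outputs `y = (y_1, …, y_s)`, where `y_t` is indexed by the inputs of level `t`. -/
abbrev Data : Type := (t : Fin s) → M.design t → ℝ

/-- The location parameters `(β, γ)`, grouped by level. -/
abbrev Loc : Type := (t : Fin s) → M.Col t → ℝ

/-- `X_t`: it is `H_t` at the first level and `[H_t, y_{t-1}(𝒳_t)]` at the later ones. -/
def X (t : Fin s) (y : M.Data) : Matrix (M.design t) (M.Col t) ℝ :=
  Matrix.of fun x => Sum.elim (M.h t x.1) (fun u => y u.1 ⟨x.1, M.nested t u.1 u.2 x.2⟩)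

/-- The correlation matrix `R_t = r(𝒳_t, 𝒳_t ∣ φ_t)`. -/
def R (t : Fin s) (φ : Fin d → ℝ) : Matrix (M.design t) (M.design t) ℝ :=
  Matrix.of fun x x' => M.r x.1 x'.1 φ

/-- The elementwise derivative of `R_t` with respect to `φ_{t,k}`. -/
def Rdot (t : Fin s) (k : Fin d) (φ : Fin d → ℝ) : Matrix (M.design t) (M.design t) ℝ :=
  Matrix.of fun x x' => deriv (fun a => M.R t (Function.update φ k a) x x') (φ k)

/-- `P_t = I - X_t (X_tᵀ R_t⁻¹ X_t)⁻¹ X_tᵀ R_t⁻¹`. -/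
def P (t : Fin s) (y : M.Data) (φ : Fin d → ℝ) : Matrix (M.design t) (M.design t) ℝ :=
  1 - M.X t y * ((M.X t y)ᵀ * (M.R t φ)⁻¹ * M.X t y)⁻¹ * (M.X t y)ᵀ * (M.R t φ)⁻¹

/-- `Q_t = R_t⁻¹ P_t`. -/
def Q (t : Fin s) (y : M.Data) (φ : Fin d → ℝ) : Matrix (M.design t) (M.design t) ℝ :=
  (M.R t φ)⁻¹ * M.P t y φ

/-- `W_{t,k} = Ṙ_t^k Q_t`. -/
def W (t : Fin s) (y : M.Data) (k : Fin d) (φ : Fin d → ℝ) :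
    Matrix (M.design t) (M.design t) ℝ :=
  M.Rdot t k φ * M.Q t y φ

/-- The `(d+1) × (d+1)` matrix `I_t^R(φ_t)`. -/
def IR (t : Fin s) (y : M.Data) (φ : Fin d → ℝ) : Matrix (Fin (d + 1)) (Fin (d + 1)) ℝ :=
  Matrix.of fun i j =>
    Fin.cases
      (Fin.cases (((M.design t).card : ℝ) - (Fintype.card (M.Col t) : ℝ))
        (fun l => (M.W t y l φ).trace) j)
      (fun k => Fin.cases (M.W t y k φ).trace
        (fun l => (M.W t y k φ * M.W t y l φ).trace) j)
      i

/-- The conditional sampling density of `y_t` given `y_{t-1}`, that is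
`N(H_t β_t + W_{t-1} γ_{t-1}, σ_t² R_t)`, evaluated at `y_t`. -/
def levelDensity (t : Fin s) (b : M.Col t → ℝ) (v : ℝ) (φ : Fin d → ℝ) (y : M.Data) : ℝ :=
  gaussianDensity (M.X t y *ᵥ b) (v • M.R t φ) (y t)

/-- The sampling density `L(y ∣ β, γ, σ², φ)`; the variances `σ²` are written `v`. -/
def likelihood (b : M.Loc) (v : Fin s → ℝ) (φ : Fin s → Fin d → ℝ) (y : M.Data) : ℝ :=
  ∏ t, M.levelDensity t (b t) (v t) (φ t) y

/-- The prior `π^R(β, γ ∣ σ², φ) ∝ 1` of the nuisance parameters. -/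
def locationPrior (_b : M.Loc) : ℝ := 1

/-- The integrated likelihood `L^I(σ², φ ∣ y)`. -/
def integratedLikelihood (v : Fin s → ℝ) (φ : Fin s → Fin d → ℝ) (y : M.Data) : ℝ :=
  ∫ b : M.Loc, M.likelihood b v φ y * M.locationPrior b

/-- The logarithm of the integrated likelihood. -/
def logIntegrated (v : Fin s → ℝ) (φ : Fin s → Fin d → ℝ) (y : M.Data) : ℝ :=
  Real.log (M.integratedLikelihood v φ y)

/-- The log integrated likelihood as a function of the `i`-th coordinate of
`ϑ_t = (σ_t², φ_{t,1}, …, φ_{t,d})`, all other parameters being fixed. -/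
def logIntegratedAlong (t : Fin s) (v : Fin s → ℝ) (φ : Fin s → Fin d → ℝ) (y : M.Data)
    (i : Fin (d + 1)) : ℝ → ℝ :=
  Fin.cases (fun a => M.logIntegrated (Function.update v t a) φ y)
    (fun k a => M.logIntegrated v (Function.update φ t (Function.update (φ t) k a)) y) i

/-- The `i`-th coordinate of `ϑ_t = (σ_t², φ_{t,1}, …, φ_{t,d})`. -/
def interest (t : Fin s) (v : Fin s → ℝ) (φ : Fin s → Fin d → ℝ) (i : Fin (d + 1)) : ℝ :=
  Fin.cases (v t) (fun k => φ t k) i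

/-- The score `∂ ℓ^I / ∂ ϑ_{t,i}`. -/
def score (t : Fin s) (v : Fin s → ℝ) (φ : Fin s → Fin d → ℝ) (y : M.Data)
    (i : Fin (d + 1)) : ℝ :=
  deriv (M.logIntegratedAlong t v φ y i) (interest t v φ i)

/-- Values of the outputs of the levels `t, …, s`. -/
abbrev Tail (t : Fin s) : Type := (u : Finset.Ici t) → M.design u.1 → ℝ

/-- The outputs that agree with `y` below level `t` and with `z` from level `t` on. -/
def glue (t : Fin s) (y : M.Data) (z : M.Tail t) : M.Data :=
  Function.updateFinset y (Finset.Ici t) z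

/-- The sampling density of `(y_t, …, y_s)` at `z`, given that the outputs of the levels below `t`
are those of `y`. -/
def tailDensity (t : Fin s) (b : M.Loc) (v : Fin s → ℝ) (φ : Fin s → Fin d → ℝ)
    (y : M.Data) (z : M.Tail t) : ℝ :=
  ∏ u ∈ Finset.Ici t, M.levelDensity u (b u) (v u) (φ u) (M.glue t y z)

/-- The Fisher information matrix of `ϑ_t = (σ_t², φ_t)` in the integrated likelihood, with all
other parameters fixed: the sampling expectation of the products of the scores, given the outputs
of the levels below `t`. -/
def fisherInfo (t : Fin s) (b : M.Loc) (v : Fin s → ℝ) (φ : Fin s → Fin d → ℝ) (y : M.Data) :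
    Matrix (Fin (d + 1)) (Fin (d + 1)) ℝ :=
  Matrix.of fun i j =>
    ∫ z : M.Tail t, M.score t v φ (M.glue t y z) i * M.score t v φ (M.glue t y z) j *
      M.tailDensity t b v φ y z

/-- The Fisher information of level `t` exists: almost surely the integral defining the integrated
likelihood converges to a positive number and the log integrated likelihood has all its partial
derivatives in `ϑ_t`, and the products of the scores have finite expectations. -/
def FisherInfoExists (t : Fin s) (b : M.Loc) (v : Fin s → ℝ) (φ : Fin s → Fin d → ℝ)
    (y : M.Data) : Prop :=
  (∀ᵐ z : M.Tail t,
    Integrable (fun b' : M.Loc => M.likelihood b' v φ (M.glue t y z) * M.locationPrior b') ∧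
    0 < M.integratedLikelihood v φ (M.glue t y z) ∧
    ∀ i, DifferentiableAt ℝ (M.logIntegratedAlong t v φ (M.glue t y z) i)
      (interest t v φ i)) ∧
  ∀ i j, Integrable fun z : M.Tail t =>
    M.score t v φ (M.glue t y z) i * M.score t v φ (M.glue t y z) j *
      M.tailDensity t b v φ y z

/-- The independent reference prior `π^R(θ) = π^R(β, γ ∣ σ², φ) π^R(σ², φ)`: the flat prior for
`(β, γ)` times the product over the levels of the priors `∝ det(Fisher information)^{1/2}`
of `(σ_t², φ_t)` computed from the integrated likelihood. -/
def referencePrior (y : M.Data) (b : M.Loc) (v : Fin s → ℝ) (φ : Fin s → Fin d → ℝ) : ℝ :=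
  M.locationPrior b * ∏ t, Real.sqrt (M.fisherInfo t b v φ y).det

/-- The parameters lie in `Ω`: all `σ_t²` and all `φ_{t,k}` are positive. -/
def InParamSpace (v : Fin s → ℝ) (φ : Fin s → Fin d → ℝ) : Prop :=
  (∀ t, 0 < v t) ∧ ∀ t k, 0 < φ t k

/-- The prior density `π` is proportional on `Ω` to `πφ(φ) / ∏ (σ_t²)^{a_t}`. -/
def HasForm (π : M.Loc → (Fin s → ℝ) → (Fin s → Fin d → ℝ) → ℝ)
    (πφ : (Fin s → Fin d → ℝ) → ℝ) (a : Fin s → ℝ) : Prop :=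
  ∃ C : ℝ, 0 < C ∧ ∀ b v φ, InParamSpace v φ →
    π b v φ = C * (πφ φ / ∏ t, (v t) ^ (a t))

end Model

end Cokriging

end

/-! For fixed outputs the likelihood is a product over levels, and each factor contains only its own
location vector. The integral over the locations therefore factors, and completing the square in
each factor gives `logMarginal`. So `ℓ^I` is a sum over levels, and only the summand of level `t`
moves with `ϑ_t`.

Write `V = σ² R`. Since `Q X = 0`, the form `yᵀ Q y` equals the same form in the residual `y - X b`,
for every `b`. Since `Q R Q = Q` and `tr (Q R) = n - q`, the log-determinant terms of the derivative
are exactly the centring terms. Each score is thus half a centred quadratic form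
(`hasDerivAt_logMarginal_variance`, `hasDerivAt_logMarginal_correlation`), with matrix proportional
to `Q D Q`, where `D` is `R` or one of its derivatives. Under `N(X b, V)` the product of two centred
forms with matrices `A`, `A'` has mean `2 tr (A V A' V)` (`integral_centredQuadratic_mul`). With `Q
R Q = Q` these traces become the entries of `IR`, up to the scale of `σ²`.

Two points concern the expectation over `(y_t, …, y_s)`. The later levels integrate out, because
each conditional density has mass one (`map_eval_withDensity_tailDensity`). The score formula also
needs the later, random regression matrices to have full column rank. This can fail only if some
output vector lies in a linear subspace that misses the observed one, hence in a proper and null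
subspace (`ae_linearIndependent_X`).

Taking determinants, the scale matrix enters twice and contributes `σ⁻⁴`, whose square root is `1 /
σ²`; this is `a_t = 1`. -/

noncomputable section

namespace Cokriging

/-! ### Gaussian laws and second moments of quadratic forms. -/

section Gaussian

open ProbabilityTheory

variable {ι : Type*} [Fintype ι]

theorem pi_gaussianReal_eq_withDensity :
    Measure.pi (fun _ : ι => gaussianReal 0 1) =
      volume.withDensity fun x => ENNReal.ofReal (∏ i, gaussianPDFReal 0 1 (x i)) := by
  refine Measure.pi_eq fun s hs => ?_
  rw [withDensity_apply _ (MeasurableSet.univ_pi hs), volume_pi, Measure.restrict_pi_pi,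
    ← ofReal_integral_eq_lintegral_ofReal
      (Integrable.fintype_prod fun i => (integrable_gaussianPDFReal 0 1).restrict)
      (Filter.Eventually.of_forall fun x =>
        Finset.prod_nonneg fun i _ => gaussianPDFReal_nonneg _ _ _),
    integral_fintype_prod_eq_prod (fun _ : ι => gaussianPDFReal 0 1),
    ENNReal.ofReal_prod_of_nonneg fun i _ => integral_nonneg fun x => gaussianPDFReal_nonneg _ _ _]
  refine Finset.prod_congr rfl fun i _ => ?_
  rw [gaussianReal_apply_eq_integral 0 one_ne_zero]

/-- The centred quadratic form `(w - m)ᵀ A (w - m) - tr (A V)`. -/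
def centredQuadratic (m : ι → ℝ) (V A : Matrix ι ι ℝ) (w : ι → ℝ) : ℝ :=
  (w - m) ⬝ᵥ (A *ᵥ (w - m)) - (A * V).trace

theorem centredQuadratic_add (m : ι → ℝ) (V A A' : Matrix ι ι ℝ) (w : ι → ℝ) :
    centredQuadratic m V (A + A') w = centredQuadratic m V A w + centredQuadratic m V A' w := by
  simp only [centredQuadratic, add_mulVec, dotProduct_add, Matrix.add_mul, trace_add]
  ring

variable [DecidableEq ι]

/-- With the prefactors moved into the exponent, identities between densities reduce to identities
between exponents. -/
theorem gaussianDensity_eq_exp (m : ι → ℝ) {V : Matrix ι ι ℝ} (hV : 0 < V.det) (y : ι → ℝ) :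
    gaussianDensity m V y = Real.exp (-(Fintype.card ι : ℝ) / 2 * Real.log (2 * Real.pi) -
      1 / 2 * Real.log V.det - 1 / 2 * ((y - m) ⬝ᵥ (V⁻¹ *ᵥ (y - m)))) := by
  rw [gaussianDensity, Real.rpow_def_of_pos (by positivity), Real.rpow_def_of_pos hV,
    ← Real.exp_add, ← Real.exp_add]
  congr 1
  ring

theorem gaussianDensity_pos (m : ι → ℝ) {V : Matrix ι ι ℝ} (hV : 0 < V.det) (y : ι → ℝ) :
    0 < gaussianDensity m V y := by
  rw [gaussianDensity_eq_exp m hV]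
  exact Real.exp_pos _

/-- Because `Bᵀ (B Bᵀ)⁻¹ B = 1`, the quadratic form at `m + B x` is the sum of squares of `x`. The
factor `|det B|` is the Jacobian. -/
theorem prod_gaussianPDFReal_eq (m : ι → ℝ) {B : Matrix ι ι ℝ} (hB : B.det ≠ 0) (x : ι → ℝ) :
    ∏ i, gaussianPDFReal 0 1 (x i) =
      |B.det| * gaussianDensity m (B * Bᵀ) (m + B *ᵥ x) := by
  have hdet : (B * Bᵀ).det = |B.det| ^ 2 := by simp [det_mul, sq]
  have hpos : 0 < |B.det| := abs_pos.mpr hB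
  have hq : (m + B *ᵥ x - m) ⬝ᵥ ((B * Bᵀ)⁻¹ *ᵥ (m + B *ᵥ x - m)) = ∑ i, x i ^ 2 := by
    have hu : IsUnit B.det := isUnit_iff_ne_zero.mpr hB
    rw [add_sub_cancel_left, Matrix.mul_inv_rev, mulVec_mulVec, Matrix.mul_assoc,
      nonsing_inv_mul _ hu, Matrix.mul_one, dotProduct_mulVec, vecMul_mulVec,
      ← dotProduct_mulVec, ← transpose_nonsing_inv, ← transpose_mul, nonsing_inv_mul _ hu]
    simp [dotProduct, sq]
  rw [gaussianDensity_eq_exp _ (by rw [hdet]; positivity), hq, hdet, Real.log_pow]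
  have hx : ∀ i, gaussianPDFReal 0 1 (x i) =
      Real.exp (-1 / 2 * Real.log (2 * Real.pi) - 1 / 2 * x i ^ 2) := by
    intro i
    simp only [gaussianPDFReal_def]
    rw [Real.sqrt_eq_rpow, ← Real.rpow_neg (by positivity),
      NNReal.coe_one, mul_one, Real.rpow_def_of_pos (by positivity), ← Real.exp_add]
    congr 1
    ring
  rw [Finset.prod_congr rfl fun i _ => hx i, ← Real.exp_sum, ← Real.exp_log hpos, ← Real.exp_add,
    Real.exp_log hpos]
  congr 1
  simp [Finset.sum_sub_distrib, ← Finset.mul_sum]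
  ring

/-- The law with density `gaussianDensity m V`. -/
def gaussianLaw (m : ι → ℝ) (V : Matrix ι ι ℝ) : Measure (ι → ℝ) :=
  volume.withDensity fun w => ENNReal.ofReal (gaussianDensity m V w)

theorem continuous_gaussianDensity (m : ι → ℝ) (V : Matrix ι ι ℝ) :
    Continuous (gaussianDensity m V) := by
  unfold gaussianDensity
  fun_prop

theorem map_pi_gaussianReal (m : ι → ℝ) {B : Matrix ι ι ℝ} (hB : B.det ≠ 0) :
    (Measure.pi fun _ : ι => gaussianReal 0 1).map (fun x => m + B *ᵥ x) =
      gaussianLaw m (B * Bᵀ) := by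
  have hT : Measurable (fun x : ι → ℝ => m + B *ᵥ x) := by fun_prop
  refine Measure.ext_of_lintegral _ fun f hf => ?_
  have hD : Measurable fun w => ENNReal.ofReal (gaussianDensity m (B * Bᵀ) w) :=
    (continuous_gaussianDensity _ _).measurable.ennreal_ofReal
  set F : (ι → ℝ) → ENNReal := fun w => ENNReal.ofReal (gaussianDensity m (B * Bᵀ) w) * f w
  have hF : Measurable F := hD.mul hf
  have hpos : 0 < |B.det| := abs_pos.mpr hB
  have hlin : ∫⁻ x : ι → ℝ, F (m + B *ᵥ x) = ENNReal.ofReal |B.det|⁻¹ * ∫⁻ w, F w := by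
    have h := Real.map_matrix_volume_pi_eq_smul_volume_pi hB
    have h1 : ∫⁻ x : ι → ℝ, F (m + B *ᵥ x) =
        ∫⁻ w, F (m + w) ∂(Measure.map (toLin' B) volume) := by
      rw [lintegral_map (f := fun w => F (m + w)) (hF.comp (measurable_const_add m))
        (LinearMap.continuous_on_pi _).measurable]
      rfl
    rw [h1, h, lintegral_smul_measure, abs_inv, smul_eq_mul,
      lintegral_add_left_eq_self (μ := volume) F m]
  have hP : Measurable fun x : ι → ℝ => ENNReal.ofReal (∏ i, gaussianPDFReal 0 1 (x i)) := by
    refine Measurable.ennreal_ofReal (Finset.measurable_fun_prod _ fun i _ => ?_)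
    exact (measurable_gaussianPDFReal 0 1).comp (measurable_pi_apply i)
  rw [lintegral_map hf hT, pi_gaussianReal_eq_withDensity, gaussianLaw,
    lintegral_withDensity_eq_lintegral_mul _ hD hf,
    lintegral_withDensity_eq_lintegral_mul _ hP (g := fun x => f (m + B *ᵥ x)) (hf.comp hT)]
  have : ∀ x : ι → ℝ, ((fun x : ι → ℝ => ENNReal.ofReal (∏ i, gaussianPDFReal 0 1 (x i))) *
      (fun x => f (m + B *ᵥ x)) : (ι → ℝ) → ENNReal) x =
        ENNReal.ofReal |B.det| * F (m + B *ᵥ x) := by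
    intro x
    simp only [Pi.mul_apply, F]
    rw [prod_gaussianPDFReal_eq m hB, ENNReal.ofReal_mul hpos.le, mul_assoc]
  have h2 := lintegral_congr (μ := volume) this
  rw [h2, lintegral_const_mul (f := fun x => F (m + B *ᵥ x)) _ (hF.comp hT), hlin, ← mul_assoc,
    ← ENNReal.ofReal_mul hpos.le, mul_inv_cancel₀ hpos.ne']
  simp [F]

/-- The spectral theorem gives `V = C Cᵀ`. Multiplying `C` on the right by an orthogonal matrix that
diagonalises `Cᵀ A C` leaves `C Cᵀ` unchanged. -/
theorem exists_mul_transpose_eq_and_diagonal {V A : Matrix ι ι ℝ} (hV : V.PosDef)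
    (hA : A.IsSymm) : ∃ (B : Matrix ι ι ℝ) (e : ι → ℝ),
      B.det ≠ 0 ∧ B * Bᵀ = V ∧ Bᵀ * A * B = diagonal e := by
  obtain ⟨C, hC, hVC⟩ : ∃ C : Matrix ι ι ℝ, C.det ≠ 0 ∧ C * Cᵀ = V := by
    let U : Matrix ι ι ℝ := hV.isHermitian.eigenvectorUnitary
    have hs := hV.isHermitian.spectral_theorem
    rw [Unitary.conjStarAlgAut_apply] at hs
    have hVC : (U * diagonal fun i => √(hV.isHermitian.eigenvalues i)) *
        (U * diagonal fun i => √(hV.isHermitian.eigenvalues i))ᵀ = V := by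
      conv_rhs => rw [hs]
      rw [transpose_mul, diagonal_transpose, Matrix.mul_assoc, ← Matrix.mul_assoc (diagonal _),
        diagonal_mul_diagonal, ← Matrix.mul_assoc]
      congr 2
      congr 1
      ext i
      simp [Real.mul_self_sqrt (hV.eigenvalues_pos i).le]
    refine ⟨_, fun h0 => hV.det_pos.ne' ?_, hVC⟩
    rw [← hVC, det_mul, h0, zero_mul]
  have hS : (Cᵀ * A * C).IsHermitian := by
    rw [IsHermitian, conjTranspose_eq_transpose_of_trivial]
    simp [transpose_mul, hA.eq, Matrix.mul_assoc]
  let U : Matrix ι ι ℝ := hS.eigenvectorUnitary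
  have hUU : U * Uᵀ = 1 := Unitary.coe_mul_star_self hS.eigenvectorUnitary
  have hUU' : Uᵀ * U = 1 := Unitary.coe_star_mul_self hS.eigenvectorUnitary
  have hs := hS.spectral_theorem
  rw [Unitary.conjStarAlgAut_apply] at hs
  have hs' : Cᵀ * A * C = U * diagonal hS.eigenvalues * Uᵀ := hs
  have hUd : U.det ≠ 0 := fun h0 => by
    have := congrArg det hUU
    rw [det_mul, h0] at this
    simp at this
  refine ⟨C * U, hS.eigenvalues, ?_, ?_, ?_⟩
  · rw [det_mul]
    exact mul_ne_zero hC hUd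
  · rw [transpose_mul, Matrix.mul_assoc, ← Matrix.mul_assoc U, hUU, Matrix.one_mul, hVC]
  · have : (C * U)ᵀ * A * (C * U) = Uᵀ * (Cᵀ * A * C) * U := by
      simp only [transpose_mul, Matrix.mul_assoc]
    rw [this]
    calc Uᵀ * (Cᵀ * A * C) * U
        = Uᵀ * (U * diagonal hS.eigenvalues * Uᵀ) * U := by rw [← hs']
      _ = (Uᵀ * U) * diagonal hS.eigenvalues * (Uᵀ * U) := by simp only [Matrix.mul_assoc]
      _ = _ := by rw [hUU', Matrix.one_mul, Matrix.mul_one]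

theorem isProbabilityMeasure_gaussianLaw (m : ι → ℝ) {V : Matrix ι ι ℝ} (hV : V.PosDef) :
    IsProbabilityMeasure (gaussianLaw m V) := by
  -- Only a square root of `V` is wanted, so the second form is taken to be zero.
  obtain ⟨B, -, hB, rfl, -⟩ := exists_mul_transpose_eq_and_diagonal hV (isSymm_zero (n := ι))
  rw [← map_pi_gaussianReal m hB]
  exact Measure.isProbabilityMeasure_map (by fun_prop)

theorem lintegral_gaussianDensity (m : ι → ℝ) {V : Matrix ι ι ℝ} (hV : V.PosDef) :
    ∫⁻ w, ENNReal.ofReal (gaussianDensity m V w) = 1 := by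
  have := (isProbabilityMeasure_gaussianLaw m hV).measure_univ
  rwa [gaussianLaw, withDensity_apply _ MeasurableSet.univ, Measure.restrict_univ] at this

theorem integrable_gaussianDensity (m : ι → ℝ) {V : Matrix ι ι ℝ} (hV : V.PosDef) :
    Integrable (gaussianDensity m V) := by
  refine ⟨(continuous_gaussianDensity m V).aestronglyMeasurable, ?_⟩
  rw [hasFiniteIntegral_iff_ofReal
    (Filter.Eventually.of_forall fun w => (gaussianDensity_pos m hV.det_pos w).le),
    lintegral_gaussianDensity m hV]
  exact ENNReal.one_lt_top

theorem integral_gaussianDensity (m : ι → ℝ) {V : Matrix ι ι ℝ} (hV : V.PosDef) :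
    ∫ w, gaussianDensity m V w = 1 := by
  rw [integral_eq_lintegral_of_nonneg_ae
    (Filter.Eventually.of_forall fun w => (gaussianDensity_pos m hV.det_pos w).le)
    (continuous_gaussianDensity m V).aestronglyMeasurable, lintegral_gaussianDensity m hV]
  simp

theorem integral_pow_four_gaussianReal : ∫ x, x ^ 4 ∂gaussianReal 0 1 = 3 := by
  -- The moment is the fourth derivative at zero of the generating function `exp (t² / 2)`; each
  -- differentiation replaces the polynomial factor `p` by `p' + t p`.
  have hd : ∀ p p' : ℝ → ℝ, (∀ t, HasDerivAt p (p' t) t) →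
      deriv (fun t => p t * Real.exp (t ^ 2 / 2)) =
        fun t => (p' t + t * p t) * Real.exp (t ^ 2 / 2) := by
    intro p p' hp
    ext t
    have h2 : HasDerivAt (fun t : ℝ => t ^ 2 / 2) t t := by
      have := (hasDerivAt_pow 2 t).div_const 2
      simpa using this
    rw [((hp t).fun_mul h2.exp).deriv]
    ring
  have h := iteratedDeriv_mgf_zero (X := fun x : ℝ => x) (μ := gaussianReal 0 1) (by simp) 4
  have h1 : ∫ x, x ^ 4 ∂gaussianReal 0 1 =
      iteratedDeriv 4 (mgf (fun x : ℝ => x) (gaussianReal 0 1)) 0 := by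
    rw [h]; rfl
  have h0 : mgf (fun x : ℝ => x) (gaussianReal 0 1) = fun t => 1 * Real.exp (t ^ 2 / 2) := by
    rw [mgf_fun_id_gaussianReal]
    simp
  have d1 := hd (fun _ => 1) (fun _ => 0) fun t => hasDerivAt_const t 1
  -- The polynomials stay unsimplified so that each is syntactically the output of the preceding
  -- derivative.
  have d2 := hd (fun t => 0 + t * 1) (fun _ => 1) fun t => by
    simpa using hasDerivAt_id' t
  have d3 := hd (fun t => 1 + t * (0 + t * 1)) (fun t => 2 * t) fun t => by
    have := ((hasDerivAt_id t).mul (hasDerivAt_id t)).const_add 1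
    refine (this.congr_deriv (by simp; ring)).congr_of_eventuallyEq (.of_forall fun x => ?_)
    simp
  have d4 := hd (fun t => 2 * t + t * (1 + t * (0 + t * 1))) (fun t => 3 + 3 * t ^ 2) fun t => by
    have := ((hasDerivAt_id t).const_mul 3).add (hasDerivAt_pow 3 t)
    refine (this.congr_deriv (by simp)).congr_of_eventuallyEq (.of_forall fun x => ?_)
    simp
    ring
  rw [h1, h0, iteratedDeriv_succ', iteratedDeriv_succ', iteratedDeriv_succ', iteratedDeriv_one,
    d1, d2, d3, d4]
  norm_num

theorem memLp_sq_gaussianReal : MemLp (fun x : ℝ => x ^ 2) 2 (gaussianReal 0 1) := by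
  rw [memLp_two_iff_integrable_sq (by fun_prop)]
  have := (memLp_id_gaussianReal (μ := 0) (v := 1) (4 : ℕ)).integrable_norm_pow (by norm_num)
  refine this.congr (Filter.Eventually.of_forall fun x => ?_)
  simp only [id, Real.norm_eq_abs]
  rw [← pow_mul]
  exact (show Even 4 by decide).pow_abs x

theorem integral_sq_gaussianReal : ∫ x, x ^ 2 ∂gaussianReal 0 1 = 1 := by
  have h := variance_fun_id_gaussianReal (μ := 0) (v := 1)
  rw [variance_eq_integral (by fun_prop)] at h
  simpa using h

theorem variance_sq_gaussianReal : Var[fun x => x ^ 2; gaussianReal 0 1] = 2 := by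
  rw [variance_eq_sub memLp_sq_gaussianReal, integral_sq_gaussianReal]
  have : ∀ x : ℝ, ((fun x : ℝ => x ^ 2) ^ 2) x = x ^ 4 := fun x => by
    simp only [Pi.pow_apply]
    ring
  rw [integral_congr_ae (Filter.Eventually.of_forall this), integral_pow_four_gaussianReal]
  norm_num

/-- In coordinates `w = m + B x` with `B Bᵀ = V` and `Bᵀ A B = diag e`, the form is `∑ eᵢ (xᵢ² - 1)`
with independent standard normal `xᵢ`. Variances add, and each `xᵢ²` has variance `2`. -/
theorem centredQuadratic_sq (m : ι → ℝ) {V A : Matrix ι ι ℝ} (hV : V.PosDef) (hA : A.IsSymm) :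
    MemLp (centredQuadratic m V A) 2 (gaussianLaw m V) ∧
    ∫ w, centredQuadratic m V A w ^ 2 ∂gaussianLaw m V = 2 * (A * V * A * V).trace := by
  obtain ⟨B, e, hB, rfl, he⟩ := exists_mul_transpose_eq_and_diagonal hV hA
  have htr : (A * (B * Bᵀ)).trace = ∑ i, e i := by
    rw [← Matrix.mul_assoc, trace_mul_comm, ← Matrix.mul_assoc, he, trace_diagonal]
  have htr2 : (A * (B * Bᵀ) * A * (B * Bᵀ)).trace = ∑ i, e i ^ 2 := by
    have : (A * (B * Bᵀ) * A * (B * Bᵀ)).trace = ((Bᵀ * A * B) * (Bᵀ * A * B)).trace := by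
      rw [← Matrix.mul_assoc _ B, trace_mul_comm]
      simp only [Matrix.mul_assoc]
    rw [this, he, diagonal_mul_diagonal, trace_diagonal]
    simp only [sq]
  have hc : ∀ x, centredQuadratic m (B * Bᵀ) A (m + B *ᵥ x) = ∑ i, e i * x i ^ 2 - ∑ i, e i := by
    intro x
    rw [centredQuadratic, htr, add_sub_cancel_left, mulVec_mulVec, dotProduct_mulVec,
      vecMul_mulVec, ← Matrix.mul_assoc, he]
    simp [dotProduct, vecMul_diagonal]
    refine Finset.sum_congr rfl fun i _ => by ring
  have hcont : Continuous (centredQuadratic m (B * Bᵀ) A) := by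
    unfold centredQuadratic
    fun_prop
  have hT : Measurable (fun x : ι → ℝ => m + B *ᵥ x) := by fun_prop
  have hL : ∀ i, MemLp (fun x : ℝ => e i * x ^ 2) 2 (gaussianReal 0 1) := fun i =>
    memLp_sq_gaussianReal.const_mul _
  have hLs : MemLp (fun x : ι → ℝ => ∑ i, e i * x i ^ 2) 2
      (Measure.pi fun _ : ι => gaussianReal 0 1) :=
    memLp_finsetSum _ fun i _ => (hL i).comp_measurePreserving (measurePreserving_eval _ i)
  have hmean : ∫ x : ι → ℝ, ∑ i, e i * x i ^ 2 ∂(Measure.pi fun _ : ι => gaussianReal 0 1) =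
      ∑ i, e i := by
    have hi : ∀ i, MemLp (fun x : ι → ℝ => e i * x i ^ 2) 2
        (Measure.pi fun _ : ι => gaussianReal 0 1) := fun i =>
      (hL i).comp_measurePreserving (measurePreserving_eval _ i)
    rw [integral_finsetSum _ fun i _ => (hi i).integrable (by norm_num)]
    refine Finset.sum_congr rfl fun i _ => ?_
    have := integral_comp_eval (μ := fun _ : ι => gaussianReal 0 1) (i := i)
      (hL i).aestronglyMeasurable
    rw [this, integral_const_mul, integral_sq_gaussianReal, mul_one]
  rw [← map_pi_gaussianReal m hB]
  constructor
  · rw [memLp_map_measure_iff hcont.aestronglyMeasurable hT.aemeasurable]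
    have : centredQuadratic m (B * Bᵀ) A ∘ (fun x => m + B *ᵥ x) =
        fun x => ∑ i, e i * x i ^ 2 - ∑ i, e i := funext hc
    rw [this]
    exact hLs.sub (memLp_const _)
  · rw [integral_map (f := fun w => centredQuadratic m (B * Bᵀ) A w ^ 2) hT.aemeasurable
      (hcont.pow 2).aestronglyMeasurable]
    simp_rw [hc]
    have := variance_sum_pi (μ := fun _ : ι => gaussianReal 0 1) hL
    have hsum : (∑ i, fun x : ι → ℝ => e i * x i ^ 2) = fun x => ∑ i, e i * x i ^ 2 := by
      ext x; simp
    rw [hsum, variance_eq_integral hLs.aestronglyMeasurable.aemeasurable, hmean] at this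
    rw [this, htr2, Finset.mul_sum]
    refine Finset.sum_congr rfl fun i _ => ?_
    rw [variance_const_mul, variance_sq_gaussianReal, mul_comm]

theorem integral_mul_eq_of_add_sq {Ω : Type*} {mΩ : MeasurableSpace Ω} {μ : Measure Ω}
    {f g : Ω → ℝ} (hf : MemLp f 2 μ) (hg : MemLp g 2 μ) :
    ∫ w, f w * g w ∂μ =
      (∫ w, (f w + g w) ^ 2 ∂μ - ∫ w, f w ^ 2 ∂μ - ∫ w, g w ^ 2 ∂μ) / 2 := by
  have hi : Integrable (fun w => 2 * (f w * g w)) μ := (hf.integrable_mul hg).const_mul 2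
  have h : ∫ w, (f w + g w) ^ 2 ∂μ = ∫ w, f w ^ 2 + g w ^ 2 + 2 * (f w * g w) ∂μ :=
    integral_congr_ae (Filter.Eventually.of_forall fun w => by ring)
  have hs : Integrable (fun w => f w ^ 2 + g w ^ 2) μ := hf.integrable_sq.add hg.integrable_sq
  rw [h, integral_add hs hi, integral_add hf.integrable_sq hg.integrable_sq, integral_const_mul]
  ring

/-- Polarisation of the second-moment formula at `A + A'`; the two cross traces agree by cyclicity.
-/
theorem integral_centredQuadratic_mul (m : ι → ℝ) {V A A' : Matrix ι ι ℝ} (hV : V.PosDef)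
    (hA : A.IsSymm) (hA' : A'.IsSymm) :
    Integrable (fun w => centredQuadratic m V A w * centredQuadratic m V A' w)
      (gaussianLaw m V) ∧
    ∫ w, centredQuadratic m V A w * centredQuadratic m V A' w ∂gaussianLaw m V =
      2 * (A * V * A' * V).trace := by
  obtain ⟨hL, h⟩ := centredQuadratic_sq m hV hA
  obtain ⟨hL', h'⟩ := centredQuadratic_sq m hV hA'
  obtain ⟨-, hs⟩ := centredQuadratic_sq m hV (hA.add hA')
  refine ⟨hL.integrable_mul hL', ?_⟩
  simp_rw [centredQuadratic_add] at hs
  rw [integral_mul_eq_of_add_sq hL hL', h, h', hs]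
  have hc : (A' * V * A * V).trace = (A * V * A' * V).trace := by
    rw [Matrix.mul_assoc (A' * V), trace_mul_comm, ← Matrix.mul_assoc]
  simp only [Matrix.add_mul, Matrix.mul_add, trace_add, hc]
  ring

end Gaussian

/-! ### Entrywise calculus of determinants and inverses. -/

section EntryDeriv

variable {m n o : Type*}

/-- Entrywise differentiability of a matrix-valued function of one real variable. -/
def HasEntryDerivAt (A : ℝ → Matrix m n ℝ) (A' : Matrix m n ℝ) (a : ℝ) : Prop :=
  ∀ i j, HasDerivAt (fun x => A x i j) (A' i j) a

theorem HasEntryDerivAt.mul [Fintype n] {A : ℝ → Matrix m n ℝ} {A' : Matrix m n ℝ}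
    {B : ℝ → Matrix n o ℝ} {B' : Matrix n o ℝ} {a : ℝ} (hA : HasEntryDerivAt A A' a)
    (hB : HasEntryDerivAt B B' a) :
    HasEntryDerivAt (fun x => A x * B x) (A' * B a + A a * B') a := by
  intro i j
  simp only [mul_apply, Matrix.add_apply, ← Finset.sum_add_distrib]
  exact HasDerivAt.fun_sum fun k _ => (hA i k).fun_mul (hB k j)

theorem HasEntryDerivAt.const_mul_mul_const {p : Type*} [Fintype n] [Fintype o]
    {A : ℝ → Matrix n o ℝ} {A' : Matrix n o ℝ} {a : ℝ} (hA : HasEntryDerivAt A A' a)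
    (B : Matrix m n ℝ) (C : Matrix o p ℝ) :
    HasEntryDerivAt (fun x => B * A x * C) (B * A' * C) a := by
  intro i j
  simp only [mul_apply]
  exact HasDerivAt.fun_sum fun k _ => (HasDerivAt.fun_sum fun l _ =>
    (hA l k).const_mul (B i l)).mul_const (C k j)

theorem HasEntryDerivAt.sub {A B : ℝ → Matrix m n ℝ} {A' B' : Matrix m n ℝ} {a : ℝ}
    (hA : HasEntryDerivAt A A' a) (hB : HasEntryDerivAt B B' a) :
    HasEntryDerivAt (fun x => A x - B x) (A' - B') a :=
  fun i j => (hA i j).sub (hB i j)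

theorem HasEntryDerivAt.dotProduct_mulVec [Fintype m] {A : ℝ → Matrix m m ℝ} {A' : Matrix m m ℝ}
    {a : ℝ} (hA : HasEntryDerivAt A A' a) (y : m → ℝ) :
    HasDerivAt (fun x => y ⬝ᵥ (A x *ᵥ y)) (y ⬝ᵥ (A' *ᵥ y)) a := by
  simp only [dotProduct, mulVec]
  exact HasDerivAt.fun_sum fun i _ =>
    (HasDerivAt.fun_sum fun j _ => (hA i j).mul_const (y j)).const_mul (y i)

variable [Fintype m] [DecidableEq m]

/-- Jacobi's formula. -/
theorem HasEntryDerivAt.det {A : ℝ → Matrix m m ℝ} {A' : Matrix m m ℝ} {a : ℝ}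
    (hA : HasEntryDerivAt A A' a) :
    HasDerivAt (fun x => (A x).det) ((adjugate (A a) * A').trace) a := by
  have h : HasDerivAt (fun x => (A x).det)
      (∑ σ : Equiv.Perm m, ((Equiv.Perm.sign σ : ℤ) : ℝ) *
        ∑ i, (∏ j ∈ Finset.univ.erase i, A a (σ j) j) • A' (σ i) i) a := by
    simp only [det_apply']
    exact HasDerivAt.fun_sum fun σ _ =>
      (HasDerivAt.fun_finsetProd fun i _ => hA (σ i) i).const_mul _
  refine h.congr_deriv ?_
  simp only [Finset.mul_sum]
  rw [Finset.sum_comm, trace]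
  refine Finset.sum_congr rfl fun i _ => ?_
  -- For fixed `i` the sum over permutations is the determinant of `A a` with column `i` replaced by
  -- that of `A'`, which is Cramer's expression for a diagonal entry of `adj (A a) * A'`.
  have : (adjugate (A a) * A').diag i = (cramer (A a) fun k => A' k i) i := by
    rw [cramer_eq_adjugate_mulVec]
    rfl
  rw [this, cramer_apply, det_apply']
  refine Finset.sum_congr rfl fun σ _ => ?_
  rw [← Finset.mul_prod_erase Finset.univ _ (Finset.mem_univ i), updateCol_self, smul_eq_mul,
    mul_comm (A' _ _)]
  congr 2
  refine Finset.prod_congr rfl fun j hj => ?_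
  rw [updateCol_ne (Finset.ne_of_mem_erase hj)]

theorem HasEntryDerivAt.log_det {A : ℝ → Matrix m m ℝ} {A' : Matrix m m ℝ} {a : ℝ}
    (hA : HasEntryDerivAt A A' a) (h0 : (A a).det ≠ 0) :
    HasDerivAt (fun x => Real.log (A x).det) (((A a)⁻¹ * A').trace) a := by
  refine (hA.det.log h0).congr_deriv ?_
  rw [inv_def, Ring.inverse_eq_inv', Matrix.smul_mul, trace_smul, smul_eq_mul, div_eq_inv_mul]

/-- Cofactors express each entry of the inverse as a quotient of determinants, so some derivative
exists; differentiating `A A⁻¹ = 1`, valid near `a`, then determines it. -/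
theorem HasEntryDerivAt.inv {A : ℝ → Matrix m m ℝ} {A' : Matrix m m ℝ} {a : ℝ}
    (hA : HasEntryDerivAt A A' a) (h0 : (A a).det ≠ 0) :
    HasEntryDerivAt (fun x => (A x)⁻¹) (-((A a)⁻¹ * A' * (A a)⁻¹)) a := by
  have hu : IsUnit (A a).det := isUnit_iff_ne_zero.mpr h0
  have hex : ∀ i j, ∃ g, HasDerivAt (fun x => (A x)⁻¹ i j) g a := by
    intro i j
    have hup : HasEntryDerivAt (fun x => (A x).updateRow j (Pi.single i 1))
        (A'.updateRow j 0) a := by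
      intro k l
      by_cases hk : k = j
      · subst hk
        simpa using hasDerivAt_const a _
      · simpa [updateRow_ne hk] using hA k l
    refine ⟨_, ((hA.det.inv h0).mul hup.det).congr_of_eventuallyEq (.of_forall fun x => ?_)⟩
    simp [inv_def, Ring.inverse_eq_inv', adjugate_apply]
  choose G hG using hex
  have hG' : HasEntryDerivAt (fun x => (A x)⁻¹) (of G) a := hG
  have hone : HasEntryDerivAt (fun x => A x * (A x)⁻¹) 0 a := by
    intro i j
    refine (hasDerivAt_const a ((1 : Matrix m m ℝ) i j)).congr_of_eventuallyEq ?_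
    filter_upwards [hA.det.continuousAt.eventually_ne h0] with x hx
    rw [mul_nonsing_inv _ (isUnit_iff_ne_zero.mpr hx)]
  have hsum : A' * (A a)⁻¹ + A a * of G = 0 := by
    ext i j
    exact ((hA.mul hG') i j).unique (hone i j)
  have hval : of G = -((A a)⁻¹ * A' * (A a)⁻¹) := by
    have := congrArg ((A a)⁻¹ * ·) (eq_neg_of_add_eq_zero_right hsum)
    simp only [← Matrix.mul_assoc, nonsing_inv_mul _ hu, Matrix.one_mul, Matrix.mul_neg] at this
    exact this
  rwa [← hval]

end EntryDeriv

/-! ### Generalized least squares and the marginal likelihood of one level. -/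

section GeneralizedLeastSquares

variable {ι κ : Type*} [Fintype ι] [Fintype κ]

/-- By symmetry `A` annihilates the column space of `X` from both sides, so a shift by `X b` is
invisible. This turns forms in `y` into forms in the Gaussian residual. -/
theorem quadratic_residual {X : Matrix ι κ ℝ} {A : Matrix ι ι ℝ} (hA : A.IsSymm) (hAX : A * X = 0)
    (y : ι → ℝ) (b : κ → ℝ) :
    (y - X *ᵥ b) ⬝ᵥ (A *ᵥ (y - X *ᵥ b)) = y ⬝ᵥ (A *ᵥ y) := by
  have h : A *ᵥ (y - X *ᵥ b) = A *ᵥ y := by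
    rw [mulVec_sub, mulVec_mulVec, hAX, zero_mulVec, sub_zero]
  have h' : vecMul (X *ᵥ b) A = 0 := by
    rw [← mulVec_transpose, hA.eq, mulVec_mulVec, hAX, zero_mulVec]
  rw [h, sub_dotProduct, dotProduct_mulVec (X *ᵥ b), h', zero_dotProduct, sub_zero]

variable [DecidableEq ι]

theorem posDef_gram {X : Matrix ι κ ℝ} {V : Matrix ι ι ℝ} (hV : V.PosDef)
    (hX : LinearIndependent ℝ X.col) : (Xᵀ * V⁻¹ * X).PosDef := by
  have := hV.inv.conjTranspose_mul_mul_same (B := X) (mulVec_injective_iff.mpr hX)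
  rwa [conjTranspose_eq_transpose_of_trivial] at this

variable [DecidableEq κ]

/-- `V⁻¹ (I - X (Xᵀ V⁻¹ X)⁻¹ Xᵀ V⁻¹)`. -/
def glsQ (X : Matrix ι κ ℝ) (V : Matrix ι ι ℝ) : Matrix ι ι ℝ :=
  V⁻¹ * (1 - X * (Xᵀ * V⁻¹ * X)⁻¹ * Xᵀ * V⁻¹)

theorem glsQ_eq (X : Matrix ι κ ℝ) (V : Matrix ι ι ℝ) :
    glsQ X V = V⁻¹ - V⁻¹ * (X * (Xᵀ * V⁻¹ * X)⁻¹ * Xᵀ) * V⁻¹ := by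
  simp only [glsQ, Matrix.mul_sub, Matrix.mul_one, Matrix.mul_assoc]

theorem glsQ_isSymm {X : Matrix ι κ ℝ} {V : Matrix ι ι ℝ} (hV : V.IsSymm) :
    (glsQ X V).IsSymm := by
  rw [glsQ_eq, IsSymm]
  simp only [transpose_sub, transpose_mul, transpose_nonsing_inv, transpose_transpose, hV.eq,
    Matrix.mul_assoc]

variable {X : Matrix ι κ ℝ} {V : Matrix ι ι ℝ}

theorem glsQ_mul_design (hV : V.PosDef) (hX : LinearIndependent ℝ X.col) : glsQ X V * X = 0 := by
  have hu : IsUnit (Xᵀ * V⁻¹ * X).det := (posDef_gram hV hX).det_pos.ne'.isUnit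
  have h : V⁻¹ * (X * (Xᵀ * V⁻¹ * X)⁻¹ * Xᵀ) * V⁻¹ * X =
      V⁻¹ * X * ((Xᵀ * V⁻¹ * X)⁻¹ * (Xᵀ * V⁻¹ * X)) := by
    simp only [Matrix.mul_assoc]
  rw [glsQ_eq, Matrix.sub_mul, h, nonsing_inv_mul _ hu, Matrix.mul_one, sub_self]

/-- `V Q` is the identity minus a matrix with left factor `X`, and `Q X = 0` removes that second
part. -/
theorem glsQ_mul_self_mul (hV : V.PosDef) (hX : LinearIndependent ℝ X.col) :
    glsQ X V * V * glsQ X V = glsQ X V := by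
  have hu : IsUnit V.det := hV.det_pos.ne'.isUnit
  conv_lhs => rw [Matrix.mul_assoc]; enter [2]; rw [glsQ, ← Matrix.mul_assoc,
    mul_nonsing_inv _ hu, Matrix.one_mul]
  rw [Matrix.mul_sub, Matrix.mul_one]
  have := glsQ_mul_design hV hX
  simp only [← Matrix.mul_assoc, this, Matrix.zero_mul, sub_zero]

/-- The subtracted part is, cyclically, the Gram matrix times its inverse, of trace `q`. -/
theorem trace_glsQ_mul (hV : V.PosDef) (hX : LinearIndependent ℝ X.col) :
    (glsQ X V * V).trace = (Fintype.card ι : ℝ) - Fintype.card κ := by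
  have hu : IsUnit V.det := hV.det_pos.ne'.isUnit
  have hA : IsUnit (Xᵀ * V⁻¹ * X).det := (posDef_gram hV hX).det_pos.ne'.isUnit
  have h : (V⁻¹ * (X * (Xᵀ * V⁻¹ * X)⁻¹ * Xᵀ)).trace = (Fintype.card κ : ℝ) := by
    have : V⁻¹ * (X * (Xᵀ * V⁻¹ * X)⁻¹ * Xᵀ) = (V⁻¹ * X * (Xᵀ * V⁻¹ * X)⁻¹) * Xᵀ := by
      simp only [Matrix.mul_assoc]
    rw [this, trace_mul_comm, ← Matrix.mul_assoc, ← Matrix.mul_assoc, mul_nonsing_inv _ hA,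
      trace_one]
  rw [glsQ_eq, Matrix.sub_mul, nonsing_inv_mul _ hu, Matrix.mul_assoc _ V⁻¹ V,
    nonsing_inv_mul _ hu, Matrix.mul_one, trace_sub, trace_one, h]

/-- The logarithm of the likelihood of `N(X b, V)` at `y`, integrated over `b`. -/
def logMarginal (X : Matrix ι κ ℝ) (V : Matrix ι ι ℝ) (y : ι → ℝ) : ℝ :=
  -((Fintype.card ι : ℝ) - Fintype.card κ) / 2 * Real.log (2 * Real.pi) -
    1 / 2 * Real.log V.det - 1 / 2 * Real.log (Xᵀ * V⁻¹ * X).det -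
    1 / 2 * (y ⬝ᵥ (glsQ X V *ᵥ y))

/-- Completing the square in `b` around the generalized least squares estimate: the cross terms
vanish by the normal equations, and what remains is a normal density in `b` whose covariance is the
inverse Gram matrix. -/
theorem gaussianDensity_as_location_density (hV : V.PosDef) (hX : LinearIndependent ℝ X.col)
    (y : ι → ℝ) (b : κ → ℝ) :
    gaussianDensity (X *ᵥ b) V y = Real.exp (logMarginal X V y) *
      gaussianDensity ((Xᵀ * V⁻¹ * X)⁻¹ *ᵥ ((Xᵀ * V⁻¹) *ᵥ y)) (Xᵀ * V⁻¹ * X)⁻¹ b := by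
  have hA := posDef_gram hV hX
  set A := Xᵀ * V⁻¹ * X with hAdef
  have hu : IsUnit A.det := hA.det_pos.ne'.isUnit
  set c := A⁻¹ *ᵥ ((Xᵀ * V⁻¹) *ᵥ y) with hc
  have hVi : (V⁻¹)ᵀ = V⁻¹ := by
    rw [transpose_nonsing_inv, ← conjTranspose_eq_transpose_of_trivial, hV.isHermitian.eq]
  -- The normal equations for the estimate `c`.
  have he : (Xᵀ * V⁻¹) *ᵥ (y - X *ᵥ c) = 0 := by
    rw [mulVec_sub, mulVec_mulVec, ← hAdef, hc, mulVec_mulVec, mul_nonsing_inv _ hu, one_mulVec,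
      sub_self]
  have he' : V⁻¹ *ᵥ (y - X *ᵥ c) = glsQ X V *ᵥ y := by
    rw [hc, glsQ_eq, mulVec_sub, sub_mulVec]
    simp only [mulVec_mulVec, Matrix.mul_assoc, hAdef]
  have he2 : ∀ z : κ → ℝ, (X *ᵥ z) ⬝ᵥ (V⁻¹ *ᵥ (y - X *ᵥ c)) = 0 := by
    intro z
    rw [← vecMul_transpose, ← dotProduct_mulVec, mulVec_mulVec, he, dotProduct_zero]
  have he3 : ∀ z : κ → ℝ, (y - X *ᵥ c) ⬝ᵥ (V⁻¹ *ᵥ (X *ᵥ z)) = 0 := by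
    intro z
    rw [dotProduct_mulVec, ← mulVec_transpose, hVi, dotProduct_comm, he2]
  have he4 : ∀ z : κ → ℝ, (X *ᵥ z) ⬝ᵥ (V⁻¹ *ᵥ (X *ᵥ z)) = z ⬝ᵥ (A *ᵥ z) := by
    intro z
    rw [mulVec_mulVec, ← vecMul_transpose X z, ← dotProduct_mulVec, mulVec_mulVec,
      ← Matrix.mul_assoc]
  have hsplit : y - X *ᵥ b = (y - X *ᵥ c) - X *ᵥ (b - c) := by
    rw [mulVec_sub]; abel
  have hquad : (y - X *ᵥ b) ⬝ᵥ (V⁻¹ *ᵥ (y - X *ᵥ b)) =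
      y ⬝ᵥ (glsQ X V *ᵥ y) + (b - c) ⬝ᵥ (A *ᵥ (b - c)) := by
    rw [hsplit, mulVec_sub V⁻¹, sub_dotProduct, dotProduct_sub, dotProduct_sub, he2, he3,
      sub_dotProduct y, he2, he', he4]
    ring
  rw [gaussianDensity_eq_exp _ hV.det_pos, gaussianDensity_eq_exp _ hA.inv.det_pos, ← Real.exp_add,
    hquad, nonsing_inv_nonsing_inv _ hu, det_nonsing_inv, Ring.inverse_eq_inv', Real.log_inv,
    logMarginal]
  congr 1
  ring

theorem integrable_gaussianDensity_location (hV : V.PosDef) (hX : LinearIndependent ℝ X.col)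
    (y : ι → ℝ) : Integrable fun b => gaussianDensity (X *ᵥ b) V y := by
  simp_rw [gaussianDensity_as_location_density hV hX]
  exact (integrable_gaussianDensity _ (posDef_gram hV hX).inv).const_mul _

theorem integral_gaussianDensity_location (hV : V.PosDef) (hX : LinearIndependent ℝ X.col)
    (y : ι → ℝ) : ∫ b, gaussianDensity (X *ᵥ b) V y = Real.exp (logMarginal X V y) := by
  simp_rw [gaussianDensity_as_location_density hV hX]
  rw [integral_const_mul, integral_gaussianDensity _ (posDef_gram hV hX).inv, mul_one]

theorem smul_inv_of_ne_zero {v : ℝ} (hv : v ≠ 0) (hV : IsUnit V.det) :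
    (v • V)⁻¹ = v⁻¹ • V⁻¹ := by
  have := Matrix.inv_smul' (A := V) (Units.mk0 v hv) hV
  simpa [Units.smul_def] using this

theorem glsQ_smul {R : Matrix ι ι ℝ} {v : ℝ} (hv : v ≠ 0) (hR : R.PosDef)
    (hX : LinearIndependent ℝ X.col) : glsQ X (v • R) = v⁻¹ • glsQ X R := by
  have hu : IsUnit R.det := hR.det_pos.ne'.isUnit
  have hA : IsUnit (Xᵀ * R⁻¹ * X).det := (posDef_gram hR hX).det_pos.ne'.isUnit
  rw [glsQ_eq, glsQ_eq, smul_inv_of_ne_zero hv hu, Matrix.mul_smul Xᵀ, Matrix.smul_mul _ _ X,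
    smul_inv_of_ne_zero (inv_ne_zero hv) hA]
  simp only [Matrix.smul_mul, Matrix.mul_smul, smul_smul, smul_sub, inv_inv]
  rw [inv_mul_cancel_left₀ hv]

/-- The determinant of `v R` contributes `n log v` and the Gram determinant `-q log v`, which leaves
`n - q` degrees of freedom. -/
theorem logMarginal_smul {R : Matrix ι ι ℝ} {v : ℝ} (hv : 0 < v) (hR : R.PosDef)
    (hX : LinearIndependent ℝ X.col) (y : ι → ℝ) :
    logMarginal X (v • R) y =
      -((Fintype.card ι : ℝ) - Fintype.card κ) / 2 * Real.log (2 * Real.pi) -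
        ((Fintype.card ι : ℝ) - Fintype.card κ) / 2 * Real.log v -
        1 / 2 * Real.log R.det - 1 / 2 * Real.log (Xᵀ * R⁻¹ * X).det -
        1 / 2 * (v⁻¹ * (y ⬝ᵥ (glsQ X R *ᵥ y))) := by
  have hu : IsUnit R.det := hR.det_pos.ne'.isUnit
  rw [logMarginal, glsQ_smul hv.ne' hR hX, smul_inv_of_ne_zero hv.ne' hu, Matrix.mul_smul,
    Matrix.smul_mul, det_smul, det_smul, Real.log_mul (pow_ne_zero _ hv.ne') hR.det_pos.ne',
    Real.log_mul (pow_ne_zero _ (inv_ne_zero hv.ne')) (posDef_gram hR hX).det_pos.ne',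
    Real.log_pow, Real.log_pow, Real.log_inv, smul_mulVec, dotProduct_smul, smul_eq_mul]
  ring

/-- The derivative of the `log v` term is the centring constant because `tr (Q R) = n - q`. The
vector `b` is arbitrary here; later it is the sampling parameter. -/
theorem hasDerivAt_logMarginal_variance {R : Matrix ι ι ℝ} {v : ℝ} (hv : 0 < v) (hR : R.PosDef)
    (hX : LinearIndependent ℝ X.col) (y : ι → ℝ) (b : κ → ℝ) :
    HasDerivAt (fun a => logMarginal X (a • R) y)
      (1 / 2 * centredQuadratic (X *ᵥ b) (v • R) ((v⁻¹ * v⁻¹) • glsQ X R) y) v := by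
  have hRs : R.IsSymm := by
    rw [IsSymm, ← conjTranspose_eq_transpose_of_trivial, hR.isHermitian.eq]
  have hq := quadratic_residual (glsQ_isSymm hRs) (glsQ_mul_design hR hX) y b
  have h1 := ((((((hasDerivAt_id' v).log hv.ne').const_mul
    (((Fintype.card ι : ℝ) - Fintype.card κ) / 2)).const_sub
      (-((Fintype.card ι : ℝ) - Fintype.card κ) / 2 * Real.log (2 * Real.pi))).sub_const
        (1 / 2 * Real.log R.det)).sub_const (1 / 2 * Real.log (Xᵀ * R⁻¹ * X).det)).sub
    (((hasDerivAt_inv hv.ne').mul_const (y ⬝ᵥ (glsQ X R *ᵥ y))).const_mul (1 / 2))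
  refine (h1.congr_deriv ?_).congr_of_eventuallyEq ?_
  · rw [centredQuadratic, smul_mulVec, dotProduct_smul, hq, Matrix.smul_mul, Matrix.mul_smul,
      trace_smul, trace_smul, trace_glsQ_mul hR hX]
    simp only [smul_eq_mul]
    field_simp
    ring
  · filter_upwards [lt_mem_nhds hv] with a ha
    exact logMarginal_smul ha hR hX y

/-- With `S = R⁻¹` and `T = X (Xᵀ S X)⁻¹ Xᵀ` one has `Q = S - S T S`, `S' = -S R' S` and `T' = T S
R' S T`; the product rule then expands to `-Q R' Q`. -/
theorem HasEntryDerivAt.glsQ {R : ℝ → Matrix ι ι ℝ} {R' : Matrix ι ι ℝ} {a : ℝ}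
    (hR' : HasEntryDerivAt R R' a) (hR : (R a).PosDef) (hX : LinearIndependent ℝ X.col) :
    HasEntryDerivAt (fun x => glsQ X (R x)) (-(glsQ X (R a) * R' * glsQ X (R a))) a := by
  have hS := hR'.inv hR.det_pos.ne'
  have hA := hS.const_mul_mul_const Xᵀ X
  have hT := (hA.inv (posDef_gram hR hX).det_pos.ne').const_mul_mul_const X Xᵀ
  have hQ := hS.sub ((hS.mul hT).mul hS)
  simp_rw [glsQ_eq]
  convert hQ using 1
  set S := (R a)⁻¹
  have hT' : X * -((Xᵀ * S * X)⁻¹ * (Xᵀ * -(S * R' * S) * X) * (Xᵀ * S * X)⁻¹) * Xᵀ =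
      (X * (Xᵀ * S * X)⁻¹ * Xᵀ) * (S * R' * S) * (X * (Xᵀ * S * X)⁻¹ * Xᵀ) := by
    simp only [Matrix.mul_neg, Matrix.neg_mul, neg_neg, Matrix.mul_assoc]
  rw [hT']
  generalize X * (Xᵀ * S * X)⁻¹ * Xᵀ = T
  noncomm_ring

/-- The derivatives of the two log-determinants combine to `tr (Q R')`. This equals `tr (Q R' Q R)`
by `Q R Q = Q`, which is the centring term of the form with matrix `Q R' Q`. -/
theorem hasDerivAt_logMarginal_correlation {R : ℝ → Matrix ι ι ℝ} {R' : Matrix ι ι ℝ} {a v : ℝ}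
    (hv : 0 < v) (hR' : HasEntryDerivAt R R' a) (hR : ∀ᶠ x in nhds a, (R x).PosDef)
    (hX : LinearIndependent ℝ X.col) (y : ι → ℝ) (b : κ → ℝ) :
    HasDerivAt (fun x => logMarginal X (v • R x) y)
      (1 / 2 * centredQuadratic (X *ᵥ b) (v • R a)
        (v⁻¹ • (glsQ X (R a) * R' * glsQ X (R a))) y) a := by
  have hRa := hR.self_of_nhds
  have hRs : (R a).IsSymm := by
    rw [IsSymm, ← conjTranspose_eq_transpose_of_trivial, hRa.isHermitian.eq]
  have hR's : R'.IsSymm := by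
    ext i j
    refine (hR' j i).unique ((hR' i j).congr_of_eventuallyEq ?_)
    filter_upwards [hR] with x hx
    exact hx.isHermitian.apply i j
  have hS := hR'.inv hRa.det_pos.ne'
  have hA := hS.const_mul_mul_const Xᵀ X
  have h1 := (((((hR'.log_det hRa.det_pos.ne').const_mul (1 / 2)).const_sub
    (-((Fintype.card ι : ℝ) - Fintype.card κ) / 2 * Real.log (2 * Real.pi) -
        ((Fintype.card ι : ℝ) - Fintype.card κ) / 2 * Real.log v)).sub
    ((hA.log_det (posDef_gram hRa hX).det_pos.ne').const_mul (1 / 2)))).sub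
    ((((hR'.glsQ hRa hX).dotProduct_mulVec y).const_mul v⁻¹).const_mul (1 / 2))
  refine (h1.congr_deriv ?_).congr_of_eventuallyEq ?_
  · have hQs := glsQ_isSymm (X := X) hRs
    have hQX := glsQ_mul_design hRa hX
    have hq := quadratic_residual (A := glsQ X (R a) * R' * glsQ X (R a))
      (by rw [IsSymm]; simp only [transpose_mul, hQs.eq, hR's.eq, Matrix.mul_assoc])
      (by rw [Matrix.mul_assoc, hQX, Matrix.mul_zero]) y b
    have htr : (glsQ X (R a) * R' * glsQ X (R a) * R a).trace = (glsQ X (R a) * R').trace := by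
      rw [Matrix.mul_assoc (glsQ X (R a) * R'), trace_mul_comm, ← Matrix.mul_assoc,
        glsQ_mul_self_mul hRa hX]
    have htr2 : ((Xᵀ * (R a)⁻¹ * X)⁻¹ * (Xᵀ * -((R a)⁻¹ * R' * (R a)⁻¹) * X)).trace =
        -((R a)⁻¹ * (X * (Xᵀ * (R a)⁻¹ * X)⁻¹ * Xᵀ) * (R a)⁻¹ * R').trace := by
      have hcyc : (R a)⁻¹ * (X * (Xᵀ * (R a)⁻¹ * X)⁻¹ * Xᵀ) * (R a)⁻¹ * R' =
          (R a)⁻¹ * X * ((Xᵀ * (R a)⁻¹ * X)⁻¹ * Xᵀ * (R a)⁻¹ * R') := by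
        simp only [Matrix.mul_assoc]
      rw [hcyc, trace_mul_comm ((R a)⁻¹ * X), Matrix.mul_neg, Matrix.neg_mul, Matrix.mul_neg,
        trace_neg]
      simp only [Matrix.mul_assoc]
    rw [htr2, centredQuadratic, smul_mulVec, dotProduct_smul, hq, Matrix.smul_mul,
      Matrix.mul_smul, smul_smul, inv_mul_cancel₀ hv.ne', one_smul, htr, neg_mulVec,
      dotProduct_neg, glsQ_eq X (R a), Matrix.sub_mul _ _ R', trace_sub]
    simp only [smul_eq_mul]
    ring
  · filter_upwards [hR] with x hx
    rw [logMarginal_smul hv hx hX y]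
    rfl

end GeneralizedLeastSquares

/-! ### Integrating out successive conditional densities. -/

section SequentialDensities

open scoped ENNReal

variable {ι : Type*} [LinearOrder ι] {E : ι → Type*} [∀ i, MeasurableSpace (E i)]
  {μ : ∀ i, Measure (E i)} [∀ i, SigmaFinite (μ i)] {f : ι → (∀ i, E i) → ℝ≥0∞}

/-- The largest coordinate is integrated first: only its own factor depends on it, and that factor
has integral one. -/
theorem lmarginal_mul_prod_sequential (hf : ∀ u, Measurable (f u))
    (hdep : ∀ u i, u < i → ∀ x w, f u (Function.update x i w) = f u x)
    (hone : ∀ u x, ∫⁻ w, f u (Function.update x u w) ∂μ u = 1) (S : Finset ι)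
    {H : (∀ i, E i) → ℝ≥0∞} (hH : Measurable H)
    (hHdep : ∀ i ∈ S, ∀ x w, H (Function.update x i w) = H x) :
    lmarginal μ S (fun x => H x * ∏ u ∈ S, f u x) = H := by
  induction S using Finset.induction_on_max with
  | empty => simp
  | insert a S ha ih =>
    have haS : a ∉ S := fun h => lt_irrefl _ (ha a h)
    have hmeas : ∀ T : Finset ι, Measurable fun x => H x * ∏ u ∈ T, f u x := fun T =>
      hH.mul (Finset.measurable_fun_prod _ fun u _ => hf u)
    rw [lmarginal_insert' _ (hmeas _) haS]
    have hinner : (fun x => ∫⁻ w, H (Function.update x a w) *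
        ∏ u ∈ insert a S, f u (Function.update x a w) ∂μ a) =
        fun x => H x * ∏ u ∈ S, f u x := by
      ext x
      have hw : ∀ w, H (Function.update x a w) *
          ∏ u ∈ insert a S, f u (Function.update x a w) =
          (H x * ∏ u ∈ S, f u x) * f a (Function.update x a w) := by
        intro w
        rw [hHdep a (Finset.mem_insert_self a S), Finset.prod_insert haS,
          Finset.prod_congr rfl fun u hu => hdep u a (ha u hu) x w]
        ring
      simp_rw [hw]
      rw [lintegral_const_mul (f := fun w => f a (Function.update x a w)) _
        ((hf a).comp (measurable_update x)), hone, mul_one]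
    rw [hinner]
    exact ih fun i hi => hHdep i (Finset.mem_insert_of_mem hi)

theorem lmarginal_Ici_mul_prod_sequential [LocallyFiniteOrderTop ι] (hf : ∀ u, Measurable (f u))
    (hdep : ∀ u i, u < i → ∀ x w, f u (Function.update x i w) = f u x)
    (hone : ∀ u x, ∫⁻ w, f u (Function.update x u w) ∂μ u = 1) (t : ι)
    {G : (∀ i, E i) → ℝ≥0∞} (hG : Measurable G)
    (hGdep : ∀ i, t < i → ∀ x w, G (Function.update x i w) = G x) (x : ∀ i, E i) :
    lmarginal μ (Finset.Ici t) (fun x => G x * ∏ u ∈ Finset.Ici t, f u x) x =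
      ∫⁻ w, G (Function.update x t w) * f t (Function.update x t w) ∂μ t := by
  have hI : Finset.Ici t = insert t (Finset.Ioi t) := (Finset.Ioi_insert t).symm
  have ht : t ∉ Finset.Ioi t := by simp
  have hfun : (fun x => G x * ∏ u ∈ insert t (Finset.Ioi t), f u x) =
      fun x => (G x * f t x) * ∏ u ∈ Finset.Ioi t, f u x := by
    ext x
    rw [Finset.prod_insert ht, mul_assoc]
  have hGf : Measurable fun x => G x * f t x := hG.mul (hf t)
  have hm : Measurable fun x => (G x * f t x) * ∏ u ∈ Finset.Ioi t, f u x :=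
    hGf.mul (Finset.measurable_fun_prod _ fun u _ => hf u)
  rw [hI, hfun, lmarginal_insert _ hm ht,
    lmarginal_mul_prod_sequential hf hdep hone _ hGf]
  intro i hi x w
  have hi' := Finset.mem_Ioi.mp hi
  rw [hGdep i hi', hdep t i hi']

end SequentialDensities

/-! ### Conditional laws and random regression matrices of the model. -/

variable {d s : ℕ}

namespace Model

variable (M : Model d s)

theorem X_congr {t : Fin s} {y y' : M.Data} (h : ∀ u : Fin s, u < t → y u = y' u) :
    M.X t y = M.X t y' := by
  ext x c
  rcases c with c | ⟨u, hu⟩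
  · rfl
  · have := h u (Fin.lt_def.mpr (by omega))
    simp only [X, of_apply, Sum.elim_inr, this]

theorem X_update {t i : Fin s} (h : t ≤ i) (y : M.Data) (w : M.design i → ℝ) :
    M.X t (Function.update y i w) = M.X t y :=
  M.X_congr fun _ hu => Function.update_of_ne (hu.trans_le h).ne _ _

theorem glue_of_le {t u : Fin s} (h : t ≤ u) (y : M.Data) (z : M.Tail t) :
    M.glue t y z u = z ⟨u, Finset.mem_Ici.mpr h⟩ := by
  simp [glue, Function.updateFinset, h]

theorem glue_of_lt {t u : Fin s} (h : u < t) (y : M.Data) (z : M.Tail t) :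
    M.glue t y z u = y u := by
  simp [glue, Function.updateFinset, h]

theorem X_glue {t u : Fin s} (h : u ≤ t) (y : M.Data) (z : M.Tail t) :
    M.X u (M.glue t y z) = M.X u y :=
  M.X_congr fun _ hu => M.glue_of_lt (hu.trans_le h) y z

theorem continuous_X (t : Fin s) : Continuous (M.X t) := by
  refine continuous_matrix fun x c => ?_
  rcases c with c | u
  · exact continuous_const
  · exact (continuous_apply (⟨x.1, M.nested t u.1 u.2 x.2⟩ : M.design u.1)).comp
      (continuous_apply u.1)

theorem continuous_levelDensity (t : Fin s) (b : M.Col t → ℝ) (v : ℝ) (φ : Fin d → ℝ) :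
    Continuous (M.levelDensity t b v φ) := by
  have hX := M.continuous_X t
  have hm : Continuous fun y : M.Data => y t - M.X t y *ᵥ b :=
    (continuous_apply t).sub (hX.matrix_mulVec continuous_const)
  unfold levelDensity gaussianDensity
  exact continuous_const.mul (Real.continuous_exp.comp
    (((hm.dotProduct (continuous_const.matrix_mulVec hm)).neg).div_const 2))

/-- The outputs of level `t`. -/
def head (t : Fin s) (z : M.Tail t) : M.design t → ℝ :=
  z ⟨t, Finset.mem_Ici.mpr le_rfl⟩

theorem glue_self (t : Fin s) (y : M.Data) (z : M.Tail t) : M.glue t y z t = M.head t z :=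
  M.glue_of_le le_rfl y z

theorem measurable_head (t : Fin s) : Measurable (M.head t) :=
  measurable_pi_apply (⟨t, Finset.mem_Ici.mpr le_rfl⟩ : Finset.Ici t)

/-- Given the outputs below level `t`, the law of the outputs of level `t` is
`N(X_t b_t, σ_t² R_t)`. -/
theorem map_eval_withDensity_tailDensity {b : M.Loc} {v : Fin s → ℝ} {φ : Fin s → Fin d → ℝ}
    (hV : ∀ u, (v u • M.R u (φ u)).PosDef) (t : Fin s) (y : M.Data) :
    ((volume : Measure (M.Tail t)).withDensity
        fun z => ENNReal.ofReal (M.tailDensity t b v φ y z)).map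
      (M.head t) =
      gaussianLaw (M.X t y *ᵥ b t) (v t • M.R t (φ t)) := by
  have hpos : ∀ u (x : M.Data), 0 ≤ M.levelDensity u (b u) (v u) (φ u) x := fun u x =>
    (gaussianDensity_pos _ (hV u).det_pos _).le
  have hmeas : ∀ u, Measurable fun x : M.Data =>
      ENNReal.ofReal (M.levelDensity u (b u) (v u) (φ u) x) := fun u =>
    (M.continuous_levelDensity u _ _ _).measurable.ennreal_ofReal
  have hself : ∀ u (x : M.Data) w, M.levelDensity u (b u) (v u) (φ u) (Function.update x u w) =
      gaussianDensity (M.X u x *ᵥ b u) (v u • M.R u (φ u)) w := by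
    intro u x w
    rw [levelDensity, M.X_update le_rfl, Function.update_self]
  refine Measure.ext_of_lintegral _ fun g hg => ?_
  have hgt : Measurable fun x : M.Data => g (x t) := hg.comp (measurable_pi_apply t)
  have hglue : Measurable fun z : M.Tail t => M.glue t y z := measurable_updateFinset
  have htail : ∀ z, ENNReal.ofReal (M.tailDensity t b v φ y z) =
      ∏ u ∈ Finset.Ici t, ENNReal.ofReal (M.levelDensity u (b u) (v u) (φ u) (M.glue t y z)) :=
    fun z => ENNReal.ofReal_prod_of_nonneg fun u _ => hpos u _
  -- `X_u` reads only outputs below level `u`, so the density of level `u` ignores later levels and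
  -- is normalised in `y_u`.
  have hkey := lmarginal_Ici_mul_prod_sequential (μ := fun _ => volume) hmeas
    (fun u i hui x w => by
      rw [levelDensity, M.X_update hui.le, Function.update_of_ne hui.ne, levelDensity])
    (fun u x => by
      simp_rw [hself]
      exact lintegral_gaussianDensity _ (hV u)) t hgt
    (fun i hi x w => by rw [Function.update_of_ne hi.ne]) y
  simp_rw [hself, Function.update_self] at hkey
  have hmt : Measurable fun z : M.Tail t => ENNReal.ofReal (M.tailDensity t b v φ y z) := by
    simp_rw [htail]
    exact Finset.measurable_fun_prod _ fun u _ => (hmeas u).comp hglue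
  rw [lintegral_map hg (M.measurable_head t), gaussianLaw,
    lintegral_withDensity_eq_lintegral_mul _ hmt (g := fun z => g (M.head t z))
      (hg.comp (M.measurable_head t)),
    lintegral_withDensity_eq_lintegral_mul _
      (continuous_gaussianDensity _ _).measurable.ennreal_ofReal hg]
  simp only [Pi.mul_apply, mul_comm _ (g _)]
  rw [← hkey, lmarginal]
  refine lintegral_congr fun z => ?_
  rw [htail, ← M.glue_self t y z]
  rfl

/-- A level has at most one predecessor, so `X_u` is `H_u` with a single extra column. This
separates the fixed rank condition from the one on the random output `y_p`. -/
theorem linearIndependent_X_iff {u p : Fin s} (hp : p.val + 1 = u.val) (y : M.Data) :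
    LinearIndependent ℝ (M.X u y).col ↔
      LinearIndependent ℝ (fun c : Fin (M.p u) => fun x : M.design u => M.h u x.1 c) ∧
      (fun x : M.design u => y p ⟨x.1, M.nested u p hp x.2⟩) ∉
        Submodule.span ℝ (Set.range fun c : Fin (M.p u) => fun x : M.design u => M.h u x.1 c) := by
  let p' : Pred u := ⟨p, hp⟩
  let _ : Unique (Pred u) := ⟨⟨p'⟩, fun q => Subtype.ext (Fin.ext (by
    have := q.2
    simp only [p']
    omega))⟩
  set w : M.design u → ℝ := fun x => y p ⟨x.1, M.nested u p hp x.2⟩ with hw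
  have hl : (M.X u y).col ∘ Sum.inl =
      fun c : Fin (M.p u) => fun x : M.design u => M.h u x.1 c := rfl
  have hr : (M.X u y).col ∘ Sum.inr = fun _ : Pred u => w := by
    ext q x
    obtain rfl : q = p' := Subsingleton.elim _ _
    rfl
  rw [linearIndependent_sum, hl, hr, linearIndependent_unique_iff (v := fun _ : Pred u => w),
    Set.range_const]
  refine and_congr_right fun _ => ⟨fun ⟨h0, hd⟩ => (Submodule.disjoint_span_singleton' h0).mp hd,
    fun h => ?_⟩
  have h0 : w ≠ 0 := fun h0 => h (h0 ▸ Submodule.zero_mem _)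
  exact ⟨h0, (Submodule.disjoint_span_singleton' h0).mpr h⟩

/-- Regression matrices that are built from random outputs almost surely have linearly
independent columns, provided those of the observed outputs do. -/
theorem ae_linearIndependent_X {y : M.Data} (hX : ∀ u, LinearIndependent ℝ (M.X u y).col)
    (t : Fin s) :
    ∀ᵐ z : M.Tail t, ∀ u, LinearIndependent ℝ (M.X u (M.glue t y z)).col := by
  rw [ae_all_iff]
  intro u
  rcases le_or_gt u t with hut | htu
  · exact Filter.Eventually.of_forall fun z => by rw [M.X_glue hut]; exact hX u
  obtain ⟨p, hp⟩ : ∃ p : Fin s, p.val + 1 = u.val :=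
    ⟨⟨u.val - 1, by omega⟩, by have := Fin.lt_def.mp htu; simp only; omega⟩
  have htp : t ≤ p := Fin.le_def.mpr (by have := Fin.lt_def.mp htu; omega)
  obtain ⟨hH, hy⟩ := (M.linearIndependent_X_iff hp y).mp (hX u)
  -- The outputs of level `p` whose restriction to the nested design lies in the span of the basis
  -- columns. It is proper because the observed `y p` lies outside it.
  let S : Submodule ℝ (M.design p → ℝ) := Submodule.comap
    (LinearMap.funLeft ℝ ℝ fun x : M.design u => (⟨x.1, M.nested u p hp x.2⟩ : M.design p))
    (Submodule.span ℝ (Set.range fun c : Fin (M.p u) => fun x : M.design u => M.h u x.1 c))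
  have hS : S ≠ ⊤ := fun h => hy (by
    have : y p ∈ S := h ▸ Submodule.mem_top
    exact this)
  have hnull : ∀ᵐ w : M.design p → ℝ, w ∉ S := by
    rw [ae_iff]
    simpa using Measure.addHaar_submodule volume S hS
  have hqmp : Measure.QuasiMeasurePreserving
      (fun z : M.Tail t => z ⟨p, Finset.mem_Ici.mpr htp⟩) volume volume :=
    Measure.quasiMeasurePreserving_eval (fun u : Finset.Ici t =>
      (volume : Measure (M.design u.1 → ℝ))) ⟨p, Finset.mem_Ici.mpr htp⟩
  filter_upwards [hqmp.ae hnull] with z hz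
  rw [M.linearIndependent_X_iff hp]
  refine ⟨hH, fun hmem => hz ?_⟩
  rw [M.glue_of_le htp] at hmem
  exact hmem

/-! ### Integrated likelihood, scores and Fisher information. -/

variable {v : Fin s → ℝ} {φ : Fin s → Fin d → ℝ} {y : M.Data}

theorem integrable_likelihood (hV : ∀ u, (v u • M.R u (φ u)).PosDef)
    (hX : ∀ u, LinearIndependent ℝ (M.X u y).col) :
    Integrable fun b : M.Loc => M.likelihood b v φ y * M.locationPrior b := by
  simp only [locationPrior, mul_one, likelihood]
  exact Integrable.fintype_prod_dep
    (f := fun u (b : M.Col u → ℝ) => M.levelDensity u b (v u) (φ u) y)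
    fun u => integrable_gaussianDensity_location (hV u) (hX u) (y u)

theorem integratedLikelihood_eq (hV : ∀ u, (v u • M.R u (φ u)).PosDef)
    (hX : ∀ u, LinearIndependent ℝ (M.X u y).col) :
    M.integratedLikelihood v φ y =
      Real.exp (∑ u, logMarginal (M.X u y) (v u • M.R u (φ u)) (y u)) := by
  simp only [integratedLikelihood, locationPrior, mul_one, likelihood]
  rw [integral_fintype_prod_volume_eq_prod
    (fun u (b : M.Col u → ℝ) => M.levelDensity u b (v u) (φ u) y), Real.exp_sum]
  exact Finset.prod_congr rfl fun u _ => integral_gaussianDensity_location (hV u) (hX u) (y u)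

theorem logIntegrated_eq (hV : ∀ u, (v u • M.R u (φ u)).PosDef)
    (hX : ∀ u, LinearIndependent ℝ (M.X u y).col) :
    M.logIntegrated v φ y = ∑ u, logMarginal (M.X u y) (v u • M.R u (φ u)) (y u) := by
  rw [logIntegrated, M.integratedLikelihood_eq hV hX, Real.log_exp]

/-- The matrices of the quadratic forms that make up the scores of level `t`. -/
def scoreMatrix (t : Fin s) (v : ℝ) (φ : Fin d → ℝ) (y : M.Data) (i : Fin (d + 1)) :
    Matrix (M.design t) (M.design t) ℝ :=
  Fin.cases ((v⁻¹ * v⁻¹) • M.Q t y φ) (fun k => v⁻¹ • (M.Q t y φ * M.Rdot t k φ * M.Q t y φ)) i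

theorem update_pos {κ : Type*} [DecidableEq κ] {f : κ → ℝ} (hf : ∀ k, 0 < f k) (k : κ) {a : ℝ}
    (ha : 0 < a) (j : κ) : 0 < Function.update f k a j := by
  rcases eq_or_ne j k with rfl | h
  · rwa [Function.update_self]
  · rw [Function.update_of_ne h]
    exact hf j

theorem Rdot_isSymm
    (hR : ∀ (t : Fin s) (φ : Fin d → ℝ), (∀ k, 0 < φ k) → (M.R t φ).PosDef)
    (t : Fin s) (k : Fin d) {ψ : Fin d → ℝ} (hψ : ∀ k, 0 < ψ k) : (M.Rdot t k ψ).IsSymm := by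
  ext x x'
  refine Filter.EventuallyEq.deriv_eq ?_
  filter_upwards [lt_mem_nhds (hψ k)] with a ha
  exact (hR t _ (update_pos hψ k ha)).isHermitian.apply x x'

theorem R_isSymm (hR : ∀ (t : Fin s) (φ : Fin d → ℝ), (∀ k, 0 < φ k) → (M.R t φ).PosDef)
    (t : Fin s) {ψ : Fin d → ℝ} (hψ : ∀ k, 0 < ψ k) : (M.R t ψ).IsSymm := by
  rw [IsSymm, ← conjTranspose_eq_transpose_of_trivial, (hR t ψ hψ).isHermitian.eq]

theorem scoreMatrix_isSymm
    (hR : ∀ (t : Fin s) (φ : Fin d → ℝ), (∀ k, 0 < φ k) → (M.R t φ).PosDef)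
    (t : Fin s) (a : ℝ) {ψ : Fin d → ℝ} (hψ : ∀ k, 0 < ψ k) (y : M.Data) (i : Fin (d + 1)) :
    (M.scoreMatrix t a ψ y i).IsSymm := by
  have hQ : (M.Q t y ψ).IsSymm := glsQ_isSymm (M.R_isSymm hR t hψ)
  refine Fin.cases (hQ.smul _) (fun k => ?_) i
  refine IsSymm.smul ?_ _
  rw [IsSymm]
  simp only [transpose_mul, hQ.eq, (M.Rdot_isSymm hR t k hψ).eq, Matrix.mul_assoc]

/-- Near the given parameter the log integrated likelihood is a sum over levels, and every summand
except that of level `t` is constant. -/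
theorem hasDerivAt_logIntegratedAlong
    (hR : ∀ (t : Fin s) (φ : Fin d → ℝ), (∀ k, 0 < φ k) → (M.R t φ).PosDef)
    (hdiff : ∀ (t : Fin s) (φ : Fin d → ℝ), (∀ k, 0 < φ k) →
      ∀ (k : Fin d) (x x' : M.design t),
        DifferentiableAt ℝ (fun a => M.R t (Function.update φ k a) x x') (φ k))
    (hΩ : InParamSpace v φ) (hX : ∀ u, LinearIndependent ℝ (M.X u y).col) (t : Fin s)
    (b : M.Col t → ℝ) (i : Fin (d + 1)) :
    HasDerivAt (M.logIntegratedAlong t v φ y i)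
      (1 / 2 * centredQuadratic (M.X t y *ᵥ b) (v t • M.R t (φ t))
        (M.scoreMatrix t (v t) (φ t) y i) (y t)) (interest t v φ i) := by
  obtain ⟨hv, hφ⟩ := hΩ
  refine Fin.cases ?_ (fun k => ?_) i
  · refine (((hasDerivAt_logMarginal_variance (hv t) (hR t _ (hφ t)) (hX t) (y t) b).add_const
      (∑ u ∈ Finset.univ.erase t, logMarginal (M.X u y) (v u • M.R u (φ u))
        (y u)))).congr_of_eventuallyEq ?_
    filter_upwards [lt_mem_nhds (show 0 < interest t v φ 0 from hv t)] with a ha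
    change M.logIntegrated (Function.update v t a) φ y = _
    rw [M.logIntegrated_eq (fun u => (hR u _ (hφ u)).smul (update_pos hv t ha u)) hX,
      ← Finset.add_sum_erase _ _ (Finset.mem_univ t), Function.update_self]
    congr 1
    exact Finset.sum_congr rfl fun u hu => by
      rw [Function.update_of_ne (Finset.ne_of_mem_erase hu)]
  · have hentry : HasEntryDerivAt (fun a => M.R t (Function.update (φ t) k a))
        (M.Rdot t k (φ t)) (φ t k) := fun x x' => (hdiff t _ (hφ t) k x x').hasDerivAt
    have hpd : ∀ᶠ a in nhds (φ t k), (M.R t (Function.update (φ t) k a)).PosDef := by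
      filter_upwards [lt_mem_nhds (hφ t k)] with a ha
      exact hR t _ (update_pos (hφ t) k ha)
    have hmain := hasDerivAt_logMarginal_correlation (hv t) hentry hpd (hX t) (y t) b
    rw [Function.update_eq_self] at hmain
    refine ((hmain.add_const
      (∑ u ∈ Finset.univ.erase t, logMarginal (M.X u y) (v u • M.R u (φ u))
        (y u)))).congr_of_eventuallyEq ?_
    filter_upwards [lt_mem_nhds (show 0 < interest t v φ k.succ from hφ t k)] with a ha
    change M.logIntegrated v (Function.update φ t (Function.update (φ t) k a)) y = _
    have hpos : ∀ u j, 0 < Function.update φ t (Function.update (φ t) k a) u j := by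
      intro u
      rcases eq_or_ne u t with rfl | hu
      · rw [Function.update_self]
        exact update_pos (hφ u) k ha
      · rw [Function.update_of_ne hu]
        exact hφ u
    rw [M.logIntegrated_eq (fun u => (hR u _ (hpos u)).smul (hv u)) hX,
      ← Finset.add_sum_erase _ _ (Finset.mem_univ t), Function.update_self]
    congr 1
    exact Finset.sum_congr rfl fun u hu => by
      rw [Function.update_of_ne (Finset.ne_of_mem_erase hu)]

/-- `R_t` followed by the derivatives of `R_t`. -/
def direction (t : Fin s) (ψ : Fin d → ℝ) (i : Fin (d + 1)) :
    Matrix (M.design t) (M.design t) ℝ :=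
  Fin.cases (M.R t ψ) (fun k => M.Rdot t k ψ) i

/-- The variance acts as one more direction, namely `R` itself: `Q R Q = Q` brings the corner and
border entries to the same trace form as the others. -/
theorem IR_apply {t : Fin s} {ψ : Fin d → ℝ} (hR : (M.R t ψ).PosDef)
    (hX : LinearIndependent ℝ (M.X t y).col) (i j : Fin (d + 1)) :
    M.IR t y ψ i j =
      (M.direction t ψ i * M.Q t y ψ * (M.direction t ψ j * M.Q t y ψ)).trace := by
  have hQ : M.Q t y ψ * M.R t ψ * M.Q t y ψ = M.Q t y ψ := glsQ_mul_self_mul hR hX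
  have hQR : (M.Q t y ψ * M.R t ψ).trace =
      ((M.design t).card : ℝ) - (Fintype.card (M.Col t) : ℝ) := by
    have := trace_glsQ_mul hR hX
    rwa [Fintype.card_coe] at this
  refine Fin.cases (Fin.cases ?_ (fun l => ?_) j) (fun k => Fin.cases ?_ (fun l => ?_) j) i
  · change _ = (M.R t ψ * M.Q t y ψ * (M.R t ψ * M.Q t y ψ)).trace
    rw [Matrix.mul_assoc, ← Matrix.mul_assoc (M.Q t y ψ), hQ, trace_mul_comm, hQR]
    rfl
  · change (M.Rdot t l ψ * M.Q t y ψ).trace =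
      (M.R t ψ * M.Q t y ψ * (M.Rdot t l ψ * M.Q t y ψ)).trace
    rw [trace_mul_comm (M.R t ψ * M.Q t y ψ), Matrix.mul_assoc (M.Rdot t l ψ),
      ← Matrix.mul_assoc (M.Q t y ψ), hQ]
  · change (M.Rdot t k ψ * M.Q t y ψ).trace =
      (M.Rdot t k ψ * M.Q t y ψ * (M.R t ψ * M.Q t y ψ)).trace
    rw [Matrix.mul_assoc (M.Rdot t k ψ), ← Matrix.mul_assoc (M.Q t y ψ), hQ]
  · rfl

/-- The diagonal of `diag(σ_t⁻², 1, …, 1)`. -/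
abbrev scale (a : ℝ) : Fin (d + 1) → ℝ := Fin.cons a⁻¹ fun _ : Fin d => (1 : ℝ)

theorem scoreMatrix_eq {t : Fin s} {a : ℝ} {ψ : Fin d → ℝ} (hR : (M.R t ψ).PosDef)
    (hX : LinearIndependent ℝ (M.X t y).col) (i : Fin (d + 1)) :
    M.scoreMatrix t a ψ y i =
      (scale a i * a⁻¹) • (M.Q t y ψ * M.direction t ψ i * M.Q t y ψ) := by
  refine Fin.cases ?_ (fun k => ?_) i
  · have hQ : M.Q t y ψ * M.R t ψ * M.Q t y ψ = M.Q t y ψ := glsQ_mul_self_mul hR hX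
    simp [scoreMatrix, direction, scale, hQ]
  · simp [scoreMatrix, direction, scale]

/-- Each covariance `a R` cancels one factor `a⁻¹` of a score matrix. The trace is then reduced by
cyclicity and two uses of `Q R Q = Q`. -/
theorem trace_scoreMatrix_mul {t : Fin s} {a : ℝ} (ha : a ≠ 0) {ψ : Fin d → ℝ}
    (hR : (M.R t ψ).PosDef) (hX : LinearIndependent ℝ (M.X t y).col) (i j : Fin (d + 1)) :
    (M.scoreMatrix t a ψ y i * (a • M.R t ψ) * M.scoreMatrix t a ψ y j * (a • M.R t ψ)).trace =
      scale a i * M.IR t y ψ i j * scale a j := by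
  have hQ : M.Q t y ψ * M.R t ψ * M.Q t y ψ = M.Q t y ψ := glsQ_mul_self_mul hR hX
  have hcyc : (M.Q t y ψ * M.direction t ψ i * M.Q t y ψ * M.R t ψ *
      (M.Q t y ψ * M.direction t ψ j * M.Q t y ψ) * M.R t ψ).trace = M.IR t y ψ i j := by
    rw [M.IR_apply hR hX]
    calc _ = (M.Q t y ψ * (M.direction t ψ i * (M.Q t y ψ * M.R t ψ * M.Q t y ψ) *
          M.direction t ψ j * M.Q t y ψ * M.R t ψ)).trace := by simp only [Matrix.mul_assoc]
      _ = (M.direction t ψ i * (M.Q t y ψ * M.R t ψ * M.Q t y ψ) *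
          M.direction t ψ j * (M.Q t y ψ * M.R t ψ * M.Q t y ψ)).trace := by
        rw [trace_mul_comm]
        simp only [Matrix.mul_assoc]
      _ = _ := by rw [hQ]; simp only [Matrix.mul_assoc]
  rw [M.scoreMatrix_eq hR hX, M.scoreMatrix_eq hR hX]
  simp only [Matrix.smul_mul, Matrix.mul_smul, trace_smul, hcyc, smul_eq_mul]
  field_simp

/-- The exceptional null set consists of outputs that make a later regression matrix rank deficient.
Off it, the score depends on the random outputs only through `y_t`, since `X_t` is fixed by the
conditioning. -/
theorem ae_score_eq
    (hR : ∀ (t : Fin s) (φ : Fin d → ℝ), (∀ k, 0 < φ k) → (M.R t φ).PosDef)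
    (hdiff : ∀ (t : Fin s) (φ : Fin d → ℝ), (∀ k, 0 < φ k) →
      ∀ (k : Fin d) (x x' : M.design t),
        DifferentiableAt ℝ (fun a => M.R t (Function.update φ k a) x x') (φ k))
    (hX : ∀ u, LinearIndependent ℝ (M.X u y).col) (hΩ : InParamSpace v φ) (t : Fin s)
    (b : M.Loc) :
    ∀ᵐ z : M.Tail t, ∀ i, M.score t v φ (M.glue t y z) i =
      1 / 2 * centredQuadratic (M.X t y *ᵥ b t) (v t • M.R t (φ t))
        (M.scoreMatrix t (v t) (φ t) y i) (M.head t z) := by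
  filter_upwards [M.ae_linearIndependent_X hX t] with z hz i
  rw [score, (M.hasDerivAt_logIntegratedAlong hR hdiff hΩ hz t (b t) i).deriv, M.glue_self,
    M.X_glue le_rfl]
  have hQ : M.Q t (M.glue t y z) (φ t) = M.Q t y (φ t) := by
    rw [Q, P, M.X_glue le_rfl, Q, P]
  rw [scoreMatrix, scoreMatrix, hQ]

theorem integral_head_mul_tailDensity {b : M.Loc} (hV : ∀ u, (v u • M.R u (φ u)).PosDef)
    (t : Fin s) {g : (M.design t → ℝ) → ℝ} (hg : Measurable g)
    (hgi : Integrable g (gaussianLaw (M.X t y *ᵥ b t) (v t • M.R t (φ t)))) :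
    Integrable (fun z => g (M.head t z) * M.tailDensity t b v φ y z) ∧
    ∫ z, g (M.head t z) * M.tailDensity t b v φ y z =
      ∫ w, g w ∂gaussianLaw (M.X t y *ᵥ b t) (v t • M.R t (φ t)) := by
  have hpos : ∀ z, 0 ≤ M.tailDensity t b v φ y z := fun z =>
    Finset.prod_nonneg fun u _ => (gaussianDensity_pos _ (hV u).det_pos _).le
  have hmeas : Measurable fun z : M.Tail t => ENNReal.ofReal (M.tailDensity t b v φ y z) :=
    (Finset.measurable_fun_prod _ fun u _ =>
      (M.continuous_levelDensity u _ _ _).measurable.comp measurable_updateFinset).ennreal_ofReal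
  have hfin : ∀ᵐ z : M.Tail t, ENNReal.ofReal (M.tailDensity t b v φ y z) < ⊤ :=
    Filter.Eventually.of_forall fun _ => ENNReal.ofReal_lt_top
  have hmap := M.map_eval_withDensity_tailDensity (b := b) hV t y
  have heq : ∀ z, (ENNReal.ofReal (M.tailDensity t b v φ y z)).toReal • g (M.head t z) =
      g (M.head t z) * M.tailDensity t b v φ y z := fun z => by
    rw [ENNReal.toReal_ofReal (hpos z), smul_eq_mul, mul_comm]
  constructor
  · rw [← hmap, integrable_map_measure hg.aestronglyMeasurable (M.measurable_head t).aemeasurable,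
      integrable_withDensity_iff_integrable_smul' hmeas hfin] at hgi
    exact hgi.congr (Filter.Eventually.of_forall heq)
  · rw [← hmap, integral_map (M.measurable_head t).aemeasurable hg.aestronglyMeasurable,
      integral_withDensity_eq_integral_toReal_smul hmeas hfin]
    exact (integral_congr_ae (Filter.Eventually.of_forall heq)).symm

/-- The two halves in the scores give `1 / 4`, and the moment `2 tr (A V A' V)` turns this into `1 /
2`. -/
theorem score_products
    (hR : ∀ (t : Fin s) (φ : Fin d → ℝ), (∀ k, 0 < φ k) → (M.R t φ).PosDef)
    (hdiff : ∀ (t : Fin s) (φ : Fin d → ℝ), (∀ k, 0 < φ k) →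
      ∀ (k : Fin d) (x x' : M.design t),
        DifferentiableAt ℝ (fun a => M.R t (Function.update φ k a) x x') (φ k))
    (hX : ∀ u, LinearIndependent ℝ (M.X u y).col) (hΩ : InParamSpace v φ) (t : Fin s)
    (b : M.Loc) (i j : Fin (d + 1)) :
    Integrable (fun z : M.Tail t => M.score t v φ (M.glue t y z) i *
      M.score t v φ (M.glue t y z) j * M.tailDensity t b v φ y z) ∧
    M.fisherInfo t b v φ y i j =
      1 / 2 * (scale (v t) i * M.IR t y (φ t) i j * scale (v t) j) := by
  have hV : ∀ u, (v u • M.R u (φ u)).PosDef := fun u => (hR u _ (hΩ.2 u)).smul (hΩ.1 u)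
  have hA := M.scoreMatrix_isSymm hR t (v t) (hΩ.2 t) y
  obtain ⟨hint, hval⟩ := integral_centredQuadratic_mul (M.X t y *ᵥ b t) (hV t) (hA i) (hA j)
  have hc : ∀ A : Matrix (M.design t) (M.design t) ℝ, Measurable
      (centredQuadratic (M.X t y *ᵥ b t) (v t • M.R t (φ t)) A) := fun A => by
    refine Continuous.measurable ?_
    unfold centredQuadratic
    fun_prop
  obtain ⟨hint', hval'⟩ := M.integral_head_mul_tailDensity (b := b) hV t
    (g := fun w => 1 / 4 * (centredQuadratic (M.X t y *ᵥ b t) (v t • M.R t (φ t))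
          (M.scoreMatrix t (v t) (φ t) y i) w *
        centredQuadratic (M.X t y *ᵥ b t) (v t • M.R t (φ t))
          (M.scoreMatrix t (v t) (φ t) y j) w))
    (((hc (M.scoreMatrix t (v t) (φ t) y i)).mul
      (hc (M.scoreMatrix t (v t) (φ t) y j))).const_mul (1 / 4)) (hint.const_mul (1 / 4))
  have hae : (fun z : M.Tail t => 1 / 4 *
      (centredQuadratic (M.X t y *ᵥ b t) (v t • M.R t (φ t))
          (M.scoreMatrix t (v t) (φ t) y i) (M.head t z) *
        centredQuadratic (M.X t y *ᵥ b t) (v t • M.R t (φ t))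
          (M.scoreMatrix t (v t) (φ t) y j) (M.head t z)) * M.tailDensity t b v φ y z)
      =ᵐ[volume] fun z => M.score t v φ (M.glue t y z) i *
        M.score t v φ (M.glue t y z) j * M.tailDensity t b v φ y z := by
    filter_upwards [M.ae_score_eq hR hdiff hX hΩ t b] with z hz
    rw [hz i, hz j]
    ring
  refine ⟨hint'.congr hae, ?_⟩
  rw [fisherInfo, of_apply, ← integral_congr_ae hae]
  refine hval'.trans ?_
  rw [integral_const_mul, hval,
    M.trace_scoreMatrix_mul (hΩ.1 t).ne' (hR t _ (hΩ.2 t)) (hX t)]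
  ring

theorem fisherInfoExists
    (hR : ∀ (t : Fin s) (φ : Fin d → ℝ), (∀ k, 0 < φ k) → (M.R t φ).PosDef)
    (hdiff : ∀ (t : Fin s) (φ : Fin d → ℝ), (∀ k, 0 < φ k) →
      ∀ (k : Fin d) (x x' : M.design t),
        DifferentiableAt ℝ (fun a => M.R t (Function.update φ k a) x x') (φ k))
    (hX : ∀ u, LinearIndependent ℝ (M.X u y).col) (hΩ : InParamSpace v φ) (t : Fin s)
    (b : M.Loc) :
    M.FisherInfoExists t b v φ y := by
  have hV : ∀ u, (v u • M.R u (φ u)).PosDef := fun u => (hR u _ (hΩ.2 u)).smul (hΩ.1 u)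
  refine ⟨?_, fun i j => (M.score_products hR hdiff hX hΩ t b i j).1⟩
  filter_upwards [M.ae_linearIndependent_X hX t] with z hz
  refine ⟨M.integrable_likelihood hV hz, ?_, fun i =>
    (M.hasDerivAt_logIntegratedAlong hR hdiff hΩ hz t (b t) i).differentiableAt⟩
  rw [M.integratedLikelihood_eq hV hz]
  exact Real.exp_pos _

theorem fisherInfo_eq
    (hR : ∀ (t : Fin s) (φ : Fin d → ℝ), (∀ k, 0 < φ k) → (M.R t φ).PosDef)
    (hdiff : ∀ (t : Fin s) (φ : Fin d → ℝ), (∀ k, 0 < φ k) →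
      ∀ (k : Fin d) (x x' : M.design t),
        DifferentiableAt ℝ (fun a => M.R t (Function.update φ k a) x x') (φ k))
    (hX : ∀ u, LinearIndependent ℝ (M.X u y).col) (hΩ : InParamSpace v φ) (t : Fin s)
    (b : M.Loc) :
    M.fisherInfo t b v φ y =
      (1 / 2 : ℝ) • (diagonal (scale (v t)) * M.IR t y (φ t) * diagonal (scale (v t))) := by
  ext i j
  rw [(M.score_products hR hdiff hX hΩ t b i j).2, Matrix.smul_apply, mul_diagonal, diagonal_mul,
    smul_eq_mul]

theorem sqrt_det_fisherInfo
    (hR : ∀ (t : Fin s) (φ : Fin d → ℝ), (∀ k, 0 < φ k) → (M.R t φ).PosDef)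
    (hdiff : ∀ (t : Fin s) (φ : Fin d → ℝ), (∀ k, 0 < φ k) →
      ∀ (k : Fin d) (x x' : M.design t),
        DifferentiableAt ℝ (fun a => M.R t (Function.update φ k a) x x') (φ k))
    (hX : ∀ u, LinearIndependent ℝ (M.X u y).col) (hΩ : InParamSpace v φ) (t : Fin s)
    (b : M.Loc) :
    √(M.fisherInfo t b v φ y).det =
      √((1 / 2) ^ (d + 1)) * (√(M.IR t y (φ t)).det / v t) := by
  have hdet : (M.fisherInfo t b v φ y).det =
      (1 / 2) ^ (d + 1) * ((M.IR t y (φ t)).det * ((v t)⁻¹) ^ 2) := by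
    rw [M.fisherInfo_eq hR hdiff hX hΩ, det_smul, det_mul, det_mul, det_diagonal,
      Fin.prod_univ_succ]
    simp only [scale, Fintype.card_fin, Fin.cons_zero, Fin.cons_succ, Finset.prod_const_one]
    ring
  -- Nonnegativity is supplied only for the factors other than `(M.IR t y (φ t)).det`, whose sign
  -- plays no role.
  rw [hdet, Real.sqrt_mul (by positivity), Real.sqrt_mul' _ (by positivity),
    Real.sqrt_sq (inv_nonneg.mpr (hΩ.1 t).le), ← div_eq_mul_inv]

end Model

end Cokriging

end

theorem mainTheorem4 (d s : ℕ) (M : Cokriging.Model d s) (y : M.Data)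
    (hR : ∀ (t : Fin s) (φ : Fin d → ℝ), (∀ k, 0 < φ k) → (M.R t φ).PosDef)
    (hdiff : ∀ (t : Fin s) (φ : Fin d → ℝ), (∀ k, 0 < φ k) → ∀ (k : Fin d) (x x' : M.design t),
      DifferentiableAt ℝ (fun a => M.R t (Function.update φ k a) x x') (φ k))
    (hX : ∀ t : Fin s, LinearIndependent ℝ (M.X t y).col) :
    (∀ (b : M.Loc) (v : Fin s → ℝ) (φ : Fin s → Fin d → ℝ),
      Cokriging.Model.InParamSpace v φ → ∀ t : Fin s,
        M.FisherInfoExists t b v φ y ∧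
        M.fisherInfo t b v φ y =
          (1 / 2 : ℝ) • (Matrix.diagonal (Fin.cons (v t)⁻¹ (fun _ : Fin d => (1 : ℝ))) *
            M.IR t y (φ t) *
            Matrix.diagonal (Fin.cons (v t)⁻¹ (fun _ : Fin d => (1 : ℝ))))) ∧
    M.HasForm (M.referencePrior y) (fun φ => ∏ t, Real.sqrt (M.IR t y (φ t)).det)
      (fun _ => 1) := by
  -- The constant collects the factor `1 / 2` from the `d + 1` rows of each of the `s` information
  -- matrices, under the square root.
  refine ⟨fun b v φ hΩ t => ⟨M.fisherInfoExists hR hdiff hX hΩ t b,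
    M.fisherInfo_eq hR hdiff hX hΩ t b⟩, √((1 / 2) ^ (d + 1)) ^ s, by positivity, ?_⟩
  intro b v φ hΩ
  simp only [Cokriging.Model.referencePrior, Cokriging.Model.locationPrior, one_mul,
    Real.rpow_one]
  rw [Finset.prod_congr rfl fun t _ => M.sqrt_det_fisherInfo hR hdiff hX hΩ t b,
    Finset.prod_mul_distrib, Finset.prod_div_distrib, Finset.prod_const, Finset.card_univ,
    Fintype.card_fin]
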